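/- Let $X$ be a complex Banach space and let $(T(t))_{t\ge 0}$ be a bounded $C_0$-semigroup on $X$ (so $\sup_{t\ge 0}\|T(t)\|<\infty$) whose generator $A$ satisfies $0\in\varrho(A)$. For $s>0$ let $(-A)^{-s}$ denote the fractional power of the sectorial operator $-A$, which is a bounded operator on $X$; explicitly, if $s=n+r$ with $n\in\{0,1,2,\dots\}$ and $0\le r<1$, then $(-A)^{-s}=(-A^{-1})^{n}(-A)^{-r}$, where $(-A)^{-0}=I$ and $$(-A)^{-r}=\frac{\sin(\pi r)}{\pi}\int_0^\infty \lambda^{-r}(\lambda I-A)^{-1}\,d\lambda\qquad(0<r<1).$$ For $1\le p<\infty$, a bounded linear operator $C$ on $X$ is called $L^p$-infinite-time admissible for $A$ if there exists $M>0$ such that $$\int_0^\infty\|CT(t)x\|^p\,dt\le M\|x\|^p\qquad\text{for all }x\in D(A).$$ Let $\alpha>0$ and $1\le p<\infty$ be fixed. Then the following statements are true. (a) If $(-A)^{-\alpha/p}$ is $L^p$-infinite-time admissible for $A$, then $\|T(t)A^{-1}\|=O(t^{-1/\alpha})$ as $t\to\infty$. (b) If $\|T(t)A^{-1}\|=O(t^{-1/\alpha})$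 as $t\to\infty$, then for every $\varepsilon>0$ the operator $(-A)^{-\alpha/p-\varepsilon}$ is $L^p$-infinite-time admissible for $A$. -/

import Mathlib

open Filter Topology Set MeasureTheory Asymptotics
open scoped ENNReal

/-- `T`, restricted to times `t ≥ 0`, is a `C₀`-semigroup of bounded operators on `X`.
The values of `T` at negative times are irrelevant everywhere below. -/
structure IsC0Semigroup {X : Type*} [NormedAddCommGroup X] [NormedSpace ℂ X]
    (T : ℝ → X →L[ℂ] X) : Prop where
  map_zero : T 0 = ContinuousLinearMap.id ℂ X
  map_add : ∀ s t : ℝ, 0 ≤ s → 0 ≤ t → T (s + t) = (T s).comp (T t)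
  continuousOn_orbit : ∀ x : X, ContinuousOn (fun t : ℝ => T t x) (Ici 0)

/-- A `C₀`-semigroup that is uniformly bounded on `[0, ∞)`. -/
structure IsBoundedC0Semigroup {X : Type*} [NormedAddCommGroup X] [NormedSpace ℂ X]
    (T : ℝ → X →L[ℂ] X) : Prop extends IsC0Semigroup T where
  bounded : ∃ K : ℝ, ∀ t : ℝ, 0 ≤ t → ‖T t‖ ≤ K

/-- `y` is the right derivative at `0` of the orbit of `x`, that is
`y = lim_{h ↓ 0} (T(h) x - x) / h`. -/
def HasOrbitDeriv {X : Type*} [NormedAddCommGroup X] [NormedSpace ℂ X]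
    (T : ℝ → X →L[ℂ] X) (x y : X) : Prop :=
  Tendsto (fun h : ℝ => ((h : ℂ)⁻¹) • (T h x - x)) (𝓝[>] 0) (𝓝 y)

theorem HasOrbitDeriv.add {X : Type*} [NormedAddCommGroup X] [NormedSpace ℂ X]
    {T : ℝ → X →L[ℂ] X} {x y x' y' : X} (h : HasOrbitDeriv T x y) (h' : HasOrbitDeriv T x' y') :
    HasOrbitDeriv T (x + x') (y + y') := by
  unfold HasOrbitDeriv at *
  refine (h.add h').congr fun r => ?_
  rw [← smul_add, _root_.map_add]
  congr 1
  abel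

theorem HasOrbitDeriv.smul {X : Type*} [NormedAddCommGroup X] [NormedSpace ℂ X]
    {T : ℝ → X →L[ℂ] X} {x y : X} (c : ℂ) (h : HasOrbitDeriv T x y) :
    HasOrbitDeriv T (c • x) (c • y) := by
  unfold HasOrbitDeriv at *
  refine (h.const_smul c).congr fun r => ?_
  rw [smul_comm, smul_sub, map_smul]

theorem HasOrbitDeriv.zero {X : Type*} [NormedAddCommGroup X] [NormedSpace ℂ X]
    (T : ℝ → X →L[ℂ] X) : HasOrbitDeriv T 0 0 := by
  unfold HasOrbitDeriv
  simp

theorem HasOrbitDeriv.unique {X : Type*} [NormedAddCommGroup X] [NormedSpace ℂ X]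
    {T : ℝ → X →L[ℂ] X} {x y y' : X} (h : HasOrbitDeriv T x y) (h' : HasOrbitDeriv T x y') :
    y = y' :=
  tendsto_nhds_unique h h'

/-- The (infinitesimal) generator `A` of `T`, as an unbounded operator:
`D(A)` is the set of all `x` for which `lim_{h ↓ 0} (T(h) x - x) / h` exists,
and `A x` is this limit. -/
noncomputable def generator {X : Type*} [NormedAddCommGroup X] [NormedSpace ℂ X]
    (T : ℝ → X →L[ℂ] X) : X →ₗ.[ℂ] X where
  domain :=
    { carrier := {x | ∃ y, HasOrbitDeriv T x y}
      add_mem' := fun ⟨y, hy⟩ ⟨y', hy'⟩ => ⟨y + y', hy.add hy'⟩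
      zero_mem' := ⟨0, HasOrbitDeriv.zero T⟩
      smul_mem' := fun c _ ⟨y, hy⟩ => ⟨c • y, hy.smul c⟩ }
  toFun :=
    { toFun := fun x => x.2.choose
      map_add' := fun x x' =>
        (x + x').2.choose_spec.unique (x.2.choose_spec.add x'.2.choose_spec)
      map_smul' := fun c x => (c • x).2.choose_spec.unique (x.2.choose_spec.smul c) }

/-- `R` is the bounded everywhere defined two-sided inverse of `z I - A : D(A) → X`. -/
def IsResolventAt {X : Type*} [NormedAddCommGroup X] [NormedSpace ℂ X]
    (A : X →ₗ.[ℂ] X) (z : ℂ) (R : X →L[ℂ] X) : Prop :=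
  (∀ x : X, ∃ h : R x ∈ A.domain, z • R x - A ⟨R x, h⟩ = x) ∧
    ∀ x : A.domain, R (z • (x : X) - A x) = x

/-- The resolvent set `ϱ(A)` of an unbounded operator `A`. -/
def opResolventSet {X : Type*} [NormedAddCommGroup X] [NormedSpace ℂ X]
    (A : X →ₗ.[ℂ] X) : Set ℂ :=
  {z | ∃ R : X →L[ℂ] X, IsResolventAt A z R}

open Classical in
/-- The resolvent `R(z, A) = (z I - A)⁻¹` for `z ∈ ϱ(A)` (and `0` for other `z`). -/
noncomputable def opResolvent {X : Type*} [NormedAddCommGroup X] [NormedSpace ℂ X]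
    (A : X →ₗ.[ℂ] X) (z : ℂ) : X →L[ℂ] X :=
  if h : z ∈ opResolventSet A then h.choose else 0

/-- The bounded inverse `A⁻¹ = -R(0, A)` of an operator `A` with `0 ∈ ϱ(A)`. -/
noncomputable def opInverse {X : Type*} [NormedAddCommGroup X] [NormedSpace ℂ X]
    (A : X →ₗ.[ℂ] X) : X →L[ℂ] X :=
  -opResolvent A 0

open Classical in
/-- The fractional power `(-A)^{-s}`, `s ≥ 0`, of an operator `A` with `0 ∈ ϱ(A)` such that `-A`
is sectorial (in particular for the generator `A` of a bounded `C₀`-semigroup), by Balakrishnan's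
formula. With `s = n + r`, `n = ⌊s⌋` and `0 ≤ r < 1`, it is `(-A)^{-s} = (-A⁻¹)^n (-A)^{-r}`, where
`(-A)^{-r} = (sin (π r) / π) ∫_0^∞ l^{-r} (l I - A)⁻¹ dl` for `0 < r < 1` (a Bochner integral that
converges absolutely in the operator norm) and `(-A)^0 = I`. -/
noncomputable def negPowNeg {X : Type*} [NormedAddCommGroup X] [NormedSpace ℂ X]
    (A : X →ₗ.[ℂ] X) (s : ℝ) : X →L[ℂ] X :=
  ((-opInverse A) ^ ⌊s⌋₊) *
    (if Int.fract s = 0 then 1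
      else (Real.sin (Real.pi * Int.fract s) / Real.pi) •
        ∫ l in Ioi (0 : ℝ), (l ^ (-Int.fract s)) • opResolvent A (l : ℂ))

/-- `L^p`-infinite-time admissibility, for the generator `A` of `T`, of an observation operator `C`
that is bounded on the whole space: `∫_0^∞ ‖C T(t) x‖^p dt ≤ M ‖x‖^p` for all `x ∈ D(A)`. -/
def LpInfiniteTimeAdmissible {X Y : Type*} [NormedAddCommGroup X] [NormedSpace ℂ X]
    [NormedAddCommGroup Y] [NormedSpace ℂ Y]
    (p : ℝ) (T : ℝ → X →L[ℂ] X) (C : X →L[ℂ] Y) : Prop :=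
  ∃ M : ℝ, 0 < M ∧ ∀ x ∈ (generator T).domain,
    ∫⁻ t in Ioi (0 : ℝ), ENNReal.ofReal (‖C (T t x)‖ ^ p) ≤ ENNReal.ofReal (M * ‖x‖ ^ p)

/-! Admissibility and decay are compared through bounds `‖T t * (-A)^{-s}‖ ≤ c t^{-b}`. If `C`
commutes with the semigroup and is admissible, then `C T(t) x = T(t-s) C T(s) x` gives `t ‖C T(t)
x‖^p ≤ K^p ∫_0^t ‖C T(s) x‖^p ds`, so `T t * C` decays like `t^{-1/p}`. Conversely, decay of order
`b` with `b p > 1` makes the admissibility integral converge.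

It remains to transfer decay between exponents: order `κ s` along `(-A)^{-s}` should depend linearly
on `s`. Upwards this follows from splitting `T(t) = T(t/2) T(t/2)`, so that orders add under
products (`PolyDecay.mul`). Downwards it follows from moment inequalities `‖C y‖ ≤ c ‖D y‖^θ
‖y‖^{1-θ}` applied to `y = T(t) x` (`PolyDecay.interpolate`). With `κ = 1/α`, the exponent `α/p`
corresponds exactly to order `1/p`, and the extra `ε` in (b) pushes the order past the integrability
threshold.

The transfer needs the law `(-A)^{-s-u} = (-A)^{-s} (-A)^{-u}`, which is not visible in
Balakrishnan's formula. For `ε > 0`, the power `(ε I - A)^{-s}` is a scaled average of `T` against a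
gamma distribution, and the law is the convolution identity of gamma distributions. Fubini
identifies this average with Balakrishnan's integral, and dominated convergence as `ε ↓ 0` carries
the law over to `-A` (`tendsto_shiftedPow`). -/

/-! ### Convolution of gamma distributions -/

open ProbabilityTheory in
-- For independent gamma variables of equal rate, the share `y / x` of the first in the total `x` is
-- beta distributed and independent of the total. The points `y = 0` and `y = x` are excluded
-- because the densities may disagree at the endpoints.
theorem gammaPDF_mul_gammaPDF_sub {a b r x y : ℝ} (ha : 0 < a) (hb : 0 < b) (hr : 0 < r)
    (hx : 0 < x) (hy0 : y ≠ 0) (hyx : y ≠ x) :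
    gammaPDF a r y * gammaPDF b r (-y + x) =
      gammaPDF (a + b) r x * (ENNReal.ofReal |x⁻¹| * betaPDF a b (x⁻¹ * y)) := by
  rcases lt_or_gt_of_ne hy0 with h | h
  · rw [gammaPDF_of_neg h, betaPDF_eq_zero_of_nonpos]
    · simp
    · exact mul_nonpos_of_nonneg_of_nonpos (by positivity) h.le
  rcases lt_or_gt_of_ne hyx.symm with h' | h'
  · rw [gammaPDF_of_neg (x := -y + x) (by linarith), betaPDF_eq_zero_of_one_le]
    · simp
    · rw [inv_mul_eq_div, le_div_iff₀ hx]; linarith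
  have hd : 0 < -y + x := by linarith
  rw [gammaPDF_of_nonneg h.le, gammaPDF_of_nonneg hd.le, gammaPDF_of_nonneg hx.le,
    betaPDF_of_pos_lt_one (by positivity) (by rw [inv_mul_eq_div, div_lt_one hx]; exact h')]
  have hΓa := Real.Gamma_pos_of_pos ha
  have hΓb := Real.Gamma_pos_of_pos hb
  have hΓ := Real.Gamma_pos_of_pos (add_pos ha hb)
  rw [← ENNReal.ofReal_mul (by positivity), ← ENNReal.ofReal_mul (by positivity),
    ← ENNReal.ofReal_mul (by positivity)]
  congr 1
  have e1 : (1 - x⁻¹ * y) = x⁻¹ * (-y + x) := by field_simp; ring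
  have e2 : Real.exp (-(r * x)) = Real.exp (-(r * y)) * Real.exp (-(r * (-y + x))) := by
    rw [← Real.exp_add]; ring_nf
  have e3 : x ^ (a + b - 1) = x ^ (a - 1) * x ^ (b - 1) * x := by
    nth_rw 4 [← Real.rpow_one x]
    rw [← Real.rpow_add hx, ← Real.rpow_add hx]; ring_nf
  rw [e1, e2, e3, Real.mul_rpow (by positivity) h.le, Real.mul_rpow (by positivity) hd.le,
    Real.rpow_add hr, abs_of_pos (by positivity), Real.inv_rpow hx.le, Real.inv_rpow hx.le, beta]
  have := Real.rpow_pos_of_pos hx (a - 1)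
  have := Real.rpow_pos_of_pos hx (b - 1)
  field_simp

open ProbabilityTheory in
-- Once the factor depending on `x` alone is pulled out of the convolution integral, what remains is
-- the total mass of a rescaled beta density, which is one.
theorem gammaMeasure_conv_gammaMeasure {a b r : ℝ} (ha : 0 < a) (hb : 0 < b) (hr : 0 < r) :
    Measure.conv (gammaMeasure a r) (gammaMeasure b r) = gammaMeasure (a + b) r := by
  have hm : ∀ c : ℝ, Measurable (gammaPDF c r) := fun c =>
    (measurable_gammaPDFReal c r).ennreal_ofReal
  rw [gammaMeasure, gammaMeasure, gammaMeasure,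
    conv_withDensity_eq_lconvolution (hm a) (hm b)]
  refine withDensity_congr_ae ?_
  filter_upwards [Measure.ae_ne volume (0 : ℝ)] with x hx
  rw [lconvolution_def]
  rcases lt_or_gt_of_ne hx with h | h
  · rw [gammaPDF_of_neg h]
    refine (lintegral_congr fun y => ?_).trans lintegral_zero
    rcases lt_or_ge y 0 with hy | hy
    · rw [gammaPDF_of_neg hy, zero_mul]
    · rw [gammaPDF_of_neg (x := -y + x) (by linarith), mul_zero]
  · have : ∫⁻ y, gammaPDF a r y * gammaPDF b r (-y + x) =
        ∫⁻ y, gammaPDF (a + b) r x * (ENNReal.ofReal |x⁻¹| * betaPDF a b (x⁻¹ * y)) := by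
      refine lintegral_congr_ae ?_
      filter_upwards [Measure.ae_ne volume (0 : ℝ), Measure.ae_ne volume x] with y h0 h1
      exact gammaPDF_mul_gammaPDF_sub ha hb hr h h0 h1
    have hmb : Measurable (betaPDF a b) := (measurable_betaPDFReal a b).ennreal_ofReal
    rw [this, lintegral_const_mul _ (by fun_prop), lintegral_const_mul _ (by fun_prop),
      ← lintegral_map (f := betaPDF a b) hmb (by fun_prop)]
    have key := Real.smul_map_volume_mul_left (inv_ne_zero hx)
    rw [← smul_eq_mul (ENNReal.ofReal _), ← lintegral_smul_measure, key,
      lintegral_betaPDF_eq_one ha hb, mul_one]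

/-! ### Hille–Phillips calculus and the fractional powers of `r I - A` -/

section Semigroup

variable {X : Type*} [NormedAddCommGroup X] [NormedSpace ℂ X] {T : ℝ → X →L[ℂ] X}

/-- Freezing time at `0` on the negative axis makes orbits continuous on all of `ℝ`, so they can be
integrated against measures on the line. -/
theorem IsC0Semigroup.continuous_orbit (hT : IsC0Semigroup T) (x : X) :
    Continuous fun t : ℝ => T (max t 0) x :=
  (hT.continuousOn_orbit x).comp_continuous (by fun_prop) fun t => le_max_right t 0

theorem IsC0Semigroup.map_add_apply (hT : IsC0Semigroup T) {s t : ℝ} (hs : 0 ≤ s) (ht : 0 ≤ t)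
    (x : X) : T (s + t) x = T s (T t x) := by
  rw [hT.map_add s t hs ht]; rfl

theorem IsC0Semigroup.comm (hT : IsC0Semigroup T) {s t : ℝ} (hs : 0 ≤ s) (ht : 0 ≤ t) :
    Commute (T s) (T t) := by
  change (T s).comp (T t) = (T t).comp (T s)
  rw [← hT.map_add s t hs ht, ← hT.map_add t s ht hs, add_comm]

/-- A bound for the norms of the operators of a bounded semigroup. -/
noncomputable def IsBoundedC0Semigroup.bound (hT : IsBoundedC0Semigroup T) : ℝ :=
  hT.bounded.choose

theorem IsBoundedC0Semigroup.norm_le (hT : IsBoundedC0Semigroup T) {t : ℝ} (ht : 0 ≤ t) :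
    ‖T t‖ ≤ hT.bound :=
  hT.bounded.choose_spec t ht

theorem IsBoundedC0Semigroup.bound_nonneg (hT : IsBoundedC0Semigroup T) : 0 ≤ hT.bound :=
  (norm_nonneg _).trans (hT.norm_le le_rfl)

theorem IsBoundedC0Semigroup.norm_apply_le (hT : IsBoundedC0Semigroup T) {t : ℝ} (ht : 0 ≤ t)
    (x : X) : ‖T t x‖ ≤ hT.bound * ‖x‖ :=
  (T t).le_of_opNorm_le (hT.norm_le ht) x

theorem IsBoundedC0Semigroup.integrable_orbit (hT : IsBoundedC0Semigroup T) (x : X)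
    (μ : Measure ℝ) [IsFiniteMeasure μ] : Integrable (fun t => T (max t 0) x) μ :=
  Integrable.of_bound (hT.continuous_orbit x).aestronglyMeasurable (hT.bound * ‖x‖)
    (ae_of_all _ fun t => hT.norm_apply_le (le_max_right t 0) x)

/-- The operator `∫ T(t) dμ(t)` of the Hille–Phillips calculus, for a finite measure `μ`. -/
noncomputable def IsBoundedC0Semigroup.hillePhillips (hT : IsBoundedC0Semigroup T)
    (μ : Measure ℝ) [IsFiniteMeasure μ] : X →L[ℂ] X :=
  LinearMap.mkContinuous
    { toFun := fun x => ∫ t, T (max t 0) x ∂μ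
      map_add' := fun x y => by
        simp_rw [map_add]
        exact integral_add (hT.integrable_orbit x μ) (hT.integrable_orbit y μ)
      map_smul' := fun c x => by
        simp_rw [map_smul, RingHom.id_apply]
        exact integral_smul c _ }
    (hT.bound * μ.real univ) fun x => by
      refine (norm_integral_le_of_norm_le_const (C := hT.bound * ‖x‖)
        (ae_of_all _ fun t => hT.norm_apply_le (le_max_right t 0) x)).trans_eq ?_
      ring

theorem IsBoundedC0Semigroup.hillePhillips_apply (hT : IsBoundedC0Semigroup T)
    (μ : Measure ℝ) [IsFiniteMeasure μ] (x : X) :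
    hT.hillePhillips μ x = ∫ t, T (max t 0) x ∂μ := rfl

theorem IsBoundedC0Semigroup.norm_hillePhillips_le (hT : IsBoundedC0Semigroup T)
    (μ : Measure ℝ) [IsFiniteMeasure μ] : ‖hT.hillePhillips μ‖ ≤ hT.bound * μ.real univ :=
  LinearMap.mkContinuous_norm_le _ (mul_nonneg hT.bound_nonneg measureReal_nonneg) _

open ProbabilityTheory

theorem measurable_gammaPDF (a r : ℝ) : Measurable (gammaPDF a r) :=
  (measurable_gammaPDFReal a r).ennreal_ofReal

theorem ae_gammaMeasure_nonneg (a r : ℝ) : ∀ᵐ t ∂gammaMeasure a r, 0 ≤ t := by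
  rw [gammaMeasure, ae_withDensity_iff (measurable_gammaPDF a r)]
  refine ae_of_all _ fun t ht => ?_
  by_contra h
  exact ht (gammaPDF_of_neg (not_le.mp h))

theorem integral_gammaMeasure {a r : ℝ} (ha : 0 < a) (hr : 0 < r) (f : ℝ → X) :
    ∫ t, f t ∂gammaMeasure a r =
      (r ^ a / Real.Gamma a) • ∫ t in Ioi 0, (t ^ (a - 1) * Real.exp (-(r * t))) • f t := by
  rw [gammaMeasure, integral_withDensity_eq_integral_toReal_smul
    (measurable_gammaPDF a r) (ae_of_all _ fun t => ENNReal.ofReal_lt_top),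
    ← integral_smul, ← integral_Ici_eq_integral_Ioi, ← integral_indicator measurableSet_Ici]
  congr 1
  ext t
  by_cases ht : 0 ≤ t
  · rw [indicator_of_mem (mem_Ici.mpr ht), gammaPDF, ENNReal.toReal_ofReal (gammaPDFReal_nonneg ha hr t),
      gammaPDFReal, if_pos ht, smul_smul, mul_assoc]
  · rw [indicator_of_notMem (by simpa using ht), gammaPDF_of_neg (not_le.mp ht)]
    simp

theorem IsBoundedC0Semigroup.integrableOn_exp_smul (hT : IsBoundedC0Semigroup T) {r : ℝ}
    (hr : 0 < r) (x : X) :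
    IntegrableOn (fun t => Real.exp (-(r * t)) • T (max t 0) x) (Ioi 0) := by
  have h1 : IntegrableOn (fun t => Real.exp (-r * t)) (Ioi 0) := exp_neg_integrableOn_Ioi 0 hr
  refine Integrable.mono' (h1.mul_const (hT.bound * ‖x‖)) ?_ (ae_of_all _ fun t => ?_)
  · exact Continuous.aestronglyMeasurable
      ((by fun_prop : Continuous fun t : ℝ => Real.exp (-(r * t))).smul (hT.continuous_orbit x))
  · rw [norm_smul, Real.norm_of_nonneg (Real.exp_pos _).le, neg_mul]
    exact mul_le_mul_of_nonneg_left (hT.norm_apply_le (le_max_right t 0) x) (Real.exp_pos _).le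

open Classical in
/-- The negative fractional power `(r I - A)^{-a}` of the generator `A` of `T`, for `a, r > 0`. -/
noncomputable def IsBoundedC0Semigroup.shiftedPow (hT : IsBoundedC0Semigroup T) (a r : ℝ) :
    X →L[ℂ] X :=
  if h : 0 < a ∧ 0 < r then
    have := isProbabilityMeasure_gammaMeasure h.1 h.2
    (r ^ (-a)) • hT.hillePhillips (gammaMeasure a r)
  else 0

theorem IsBoundedC0Semigroup.shiftedPow_eq (hT : IsBoundedC0Semigroup T) {a r : ℝ} (ha : 0 < a)
    (hr : 0 < r) [IsFiniteMeasure (gammaMeasure a r)] :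
    hT.shiftedPow a r = (r ^ (-a)) • hT.hillePhillips (gammaMeasure a r) :=
  dif_pos ⟨ha, hr⟩

theorem IsBoundedC0Semigroup.shiftedPow_apply (hT : IsBoundedC0Semigroup T) {a r : ℝ}
    (ha : 0 < a) (hr : 0 < r) (x : X) :
    hT.shiftedPow a r x = (Real.Gamma a)⁻¹ •
      ∫ t in Ioi 0, (t ^ (a - 1) * Real.exp (-(r * t))) • T (max t 0) x := by
  have := isProbabilityMeasure_gammaMeasure ha hr
  rw [hT.shiftedPow_eq ha hr, smul_apply, hillePhillips_apply,
    integral_gammaMeasure ha hr, smul_smul]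
  congr 1
  rw [Real.rpow_neg hr.le]
  have := Real.rpow_pos_of_pos hr a
  field_simp

theorem IsBoundedC0Semigroup.shiftedPow_one_apply (hT : IsBoundedC0Semigroup T) {r : ℝ}
    (hr : 0 < r) (x : X) :
    hT.shiftedPow 1 r x = ∫ t in Ioi 0, Real.exp (-(r * t)) • T (max t 0) x := by
  simp [hT.shiftedPow_apply one_pos hr]

theorem IsBoundedC0Semigroup.norm_shiftedPow_le (hT : IsBoundedC0Semigroup T) {a r : ℝ}
    (ha : 0 < a) (hr : 0 < r) : ‖hT.shiftedPow a r‖ ≤ r ^ (-a) * hT.bound := by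
  have := isProbabilityMeasure_gammaMeasure ha hr
  rw [hT.shiftedPow_eq ha hr, norm_smul, Real.norm_of_nonneg (Real.rpow_nonneg hr.le _)]
  refine mul_le_mul_of_nonneg_left ?_ (Real.rpow_nonneg hr.le _)
  simpa using hT.norm_hillePhillips_le (gammaMeasure a r)

variable [CompleteSpace X]

/-- Fubini and `T(s + t) = T(s) T(t)`. The measures must live on `[0, ∞)`, since the truncated time
`max t 0` is additive only there. -/
theorem IsBoundedC0Semigroup.hillePhillips_conv (hT : IsBoundedC0Semigroup T)
    (μ ν : Measure ℝ) [IsFiniteMeasure μ] [IsFiniteMeasure ν] (hμ : ∀ᵐ t ∂μ, 0 ≤ t)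
    (hν : ∀ᵐ t ∂ν, 0 ≤ t) :
    hT.hillePhillips (μ.conv ν) = hT.hillePhillips μ * hT.hillePhillips ν := by
  ext x
  rw [mul_apply_eq_comp, hillePhillips_apply, hillePhillips_apply,
    integral_conv (hT.integrable_orbit x _)]
  refine integral_congr_ae ?_
  filter_upwards [hμ] with s hs
  rw [hillePhillips_apply, ← ContinuousLinearMap.integral_comp_comm _ (hT.integrable_orbit x ν)]
  refine integral_congr_ae ?_
  filter_upwards [hν] with t ht
  rw [max_eq_left hs, max_eq_left ht, max_eq_left (add_nonneg hs ht), hT.map_add_apply hs ht]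

theorem IsBoundedC0Semigroup.hillePhillips_comm (hT : IsBoundedC0Semigroup T)
    (μ : Measure ℝ) [IsFiniteMeasure μ] {s : ℝ} (hs : 0 ≤ s) :
    Commute (T s) (hT.hillePhillips μ) := by
  ext x
  rw [mul_apply_eq_comp, mul_apply_eq_comp, hillePhillips_apply,
    hillePhillips_apply, ← ContinuousLinearMap.integral_comp_comm _ (hT.integrable_orbit x μ)]
  refine integral_congr_ae (ae_of_all _ fun t => ?_)
  exact DFunLike.congr_fun (hT.comm hs (le_max_right t 0)) x

/-- Applying `T(h)` translates the orbit, so the integral starts at `h` and the exponential weight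
gains a factor `e^{r h}`. The right side is explicitly differentiable in `h` at `0`. -/
theorem IsBoundedC0Semigroup.apply_laplace (hT : IsBoundedC0Semigroup T) {r : ℝ} (hr : 0 < r)
    (x : X) {h : ℝ} (hh : 0 ≤ h) :
    T h (∫ t in Ioi 0, Real.exp (-(r * t)) • T (max t 0) x) =
      Real.exp (r * h) • ((∫ t in Ioi 0, Real.exp (-(r * t)) • T (max t 0) x) -
        ∫ t in 0..h, Real.exp (-(r * t)) • T (max t 0) x) := by
  have hi := hT.integrableOn_exp_smul hr x
  rw [← intervalIntegral.integral_Ioi_sub_Ioi hi hh, sub_sub_cancel,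
    ← ContinuousLinearMap.integral_comp_comm _ hi, ← integral_smul]
  have hs := (measurePreserving_add_right volume h).setIntegral_preimage_emb
    (measurableEmbedding_addRight h)
    (fun t => Real.exp (r * h) • Real.exp (-(r * t)) • T (max t 0) x) (Ioi h)
  rw [← hs, preimage_add_const_Ioi, sub_self]
  refine setIntegral_congr_fun measurableSet_Ioi fun t ht => ?_
  have ht : 0 ≤ t := le_of_lt ht
  rw [ContinuousLinearMap.map_smul_of_tower, max_eq_left ht, max_eq_left (add_nonneg ht hh), add_comm t h,
    hT.map_add_apply hh ht, smul_smul, ← Real.exp_add]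
  ring_nf

theorem IsBoundedC0Semigroup.hasOrbitDeriv_laplace (hT : IsBoundedC0Semigroup T) {r : ℝ}
    (hr : 0 < r) (x : X) :
    HasOrbitDeriv T (∫ t in Ioi 0, Real.exp (-(r * t)) • T (max t 0) x)
      (r • (∫ t in Ioi 0, Real.exp (-(r * t)) • T (max t 0) x) - x) := by
  set F := ∫ t in Ioi 0, Real.exp (-(r * t)) • T (max t 0) x with hF
  have hc : Continuous fun t => Real.exp (-(r * t)) • T (max t 0) x :=
    (by fun_prop : Continuous fun t : ℝ => Real.exp (-(r * t))).smul (hT.continuous_orbit x)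
  have h1 : HasDerivAt (fun h => F - ∫ t in 0..h, Real.exp (-(r * t)) • T (max t 0) x) (-x) 0 := by
    have := (hc.integral_hasStrictDerivAt 0 0).hasDerivAt.const_sub F
    simpa [hT.map_zero] using this
  have h2 : HasDerivAt (fun h => Real.exp (r * h)) r 0 := by
    simpa using ((hasDerivAt_id (0 : ℝ)).const_mul r).exp
  have h3 := (h2.smul h1).tendsto_slope_zero_right
  simp only [Pi.smul_apply', mul_zero, Real.exp_zero, one_smul, zero_add,
    intervalIntegral.integral_same, sub_zero] at h3
  rw [neg_add_eq_sub] at h3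
  refine h3.congr' ?_
  filter_upwards [self_mem_nhdsWithin] with h hh
  rw [hF, hT.apply_laplace hr x (le_of_lt hh), ← Complex.ofReal_inv, Complex.coe_smul]

theorem IsBoundedC0Semigroup.shiftedPow_add (hT : IsBoundedC0Semigroup T) {a b r : ℝ}
    (ha : 0 < a) (hb : 0 < b) (hr : 0 < r) :
    hT.shiftedPow (a + b) r = hT.shiftedPow a r * hT.shiftedPow b r := by
  have := isProbabilityMeasure_gammaMeasure ha hr
  have := isProbabilityMeasure_gammaMeasure hb hr
  have := isProbabilityMeasure_gammaMeasure (add_pos ha hb) hr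
  have key := hT.hillePhillips_conv (gammaMeasure a r) (gammaMeasure b r)
    (ae_gammaMeasure_nonneg a r) (ae_gammaMeasure_nonneg b r)
  simp only [gammaMeasure_conv_gammaMeasure ha hb hr] at key
  rw [hT.shiftedPow_eq ha hr, hT.shiftedPow_eq hb hr, hT.shiftedPow_eq (add_pos ha hb) hr,
    smul_mul_smul_comm, key, neg_add, Real.rpow_add hr]

theorem IsBoundedC0Semigroup.shiftedPow_comm (hT : IsBoundedC0Semigroup T) {a r : ℝ}
    (ha : 0 < a) (hr : 0 < r) {s : ℝ} (hs : 0 ≤ s) : Commute (T s) (hT.shiftedPow a r) := by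
  have := isProbabilityMeasure_gammaMeasure ha hr
  rw [hT.shiftedPow_eq ha hr]
  exact (hT.hillePhillips_comm _ hs).smul_right _

end Semigroup

/-! ### The generator and its resolvent -/

section Generator

variable {X : Type*} [NormedAddCommGroup X] [NormedSpace ℂ X] {T : ℝ → X →L[ℂ] X}

theorem hasOrbitDeriv_generator (x : (generator T).domain) :
    HasOrbitDeriv T x (generator T x) :=
  x.2.choose_spec

theorem HasOrbitDeriv.mem_domain {x y : X} (h : HasOrbitDeriv T x y) : x ∈ (generator T).domain :=
  ⟨y, h⟩

theorem generator_apply_of_hasOrbitDeriv {x y : X} (h : HasOrbitDeriv T x y)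
    (hx : x ∈ (generator T).domain) : generator T ⟨x, hx⟩ = y :=
  (hasOrbitDeriv_generator ⟨x, hx⟩).unique h

theorem HasOrbitDeriv.map {x y : X} (h : HasOrbitDeriv T x y) {S : X →L[ℂ] X}
    (hS : ∀ t : ℝ, 0 ≤ t → Commute (T t) S) : HasOrbitDeriv T (S x) (S y) := by
  refine ((S.continuous.tendsto y).comp h).congr' ?_
  filter_upwards [self_mem_nhdsWithin] with t ht
  have := DFunLike.congr_fun (hS t (le_of_lt ht)) x
  simp only [mul_apply_eq_comp] at this
  simp [this]

theorem IsResolventAt.hasOrbitDeriv {z : ℂ} {R : X →L[ℂ] X} (h : IsResolventAt (generator T) z R)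
    (x : X) : HasOrbitDeriv T (R x) (z • R x - x) := by
  obtain ⟨hx, e⟩ := h.1 x
  have := hasOrbitDeriv_generator ⟨R x, hx⟩
  have e' : z • R x - x = generator T ⟨R x, hx⟩ := by rw [sub_eq_iff_eq_add', ← sub_eq_iff_eq_add, e]
  rwa [e']

theorem IsResolventAt.apply_eq {z : ℂ} {R : X →L[ℂ] X} (h : IsResolventAt (generator T) z R)
    {x y : X} (hxy : HasOrbitDeriv T x y) : R (z • x - y) = x := by
  have := h.2 ⟨x, hxy.mem_domain⟩
  rwa [generator_apply_of_hasOrbitDeriv hxy] at this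

theorem isResolventAt_generator_iff {z : ℂ} {R : X →L[ℂ] X} :
    IsResolventAt (generator T) z R ↔ (∀ x, HasOrbitDeriv T (R x) (z • R x - x)) ∧
      ∀ x y, HasOrbitDeriv T x y → R (z • x - y) = x := by
  refine ⟨fun h => ⟨h.hasOrbitDeriv, fun x y => h.apply_eq⟩, fun h => ⟨fun x => ?_, fun x => ?_⟩⟩
  · refine ⟨(h.1 x).mem_domain, ?_⟩
    rw [generator_apply_of_hasOrbitDeriv (h.1 x), sub_sub_cancel]
  · exact h.2 _ _ (hasOrbitDeriv_generator x)

theorem IsResolventAt.unique {z : ℂ} {R S : X →L[ℂ] X} (hR : IsResolventAt (generator T) z R)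
    (hS : IsResolventAt (generator T) z S) : R = S := by
  ext x
  have := hS.apply_eq (hR.hasOrbitDeriv x)
  rwa [sub_sub_cancel, eq_comm] at this

theorem IsResolventAt.opResolvent_eq {z : ℂ} {R : X →L[ℂ] X}
    (hR : IsResolventAt (generator T) z R) : opResolvent (generator T) z = R := by
  have h : z ∈ opResolventSet (generator T) := ⟨R, hR⟩
  rw [opResolvent, dif_pos h]
  exact h.choose_spec.unique hR

theorem isResolventAt_opResolvent {z : ℂ} (h : z ∈ opResolventSet (generator T)) :
    IsResolventAt (generator T) z (opResolvent (generator T) z) := by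
  obtain ⟨R, hR⟩ := h
  rwa [hR.opResolvent_eq]

/-- The resolvent identity. -/
theorem IsResolventAt.sub_eq {z w : ℂ} {R S : X →L[ℂ] X} (hR : IsResolventAt (generator T) z R)
    (hS : IsResolventAt (generator T) w S) : R - S = (w - z) • (R * S) := by
  ext x
  have := hR.apply_eq (hS.hasOrbitDeriv x)
  have e : z • S x - (w • S x - x) = x - (w - z) • S x := by rw [sub_smul]; abel
  rw [e, map_sub, map_smul] at this
  simp only [sub_apply, smul_apply, mul_apply_eq_comp]
  rw [sub_eq_iff_eq_add, add_comm, ← sub_eq_iff_eq_add, this]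

variable [CompleteSpace X]

theorem IsBoundedC0Semigroup.isResolventAt_shiftedPow_one (hT : IsBoundedC0Semigroup T) {r : ℝ}
    (hr : 0 < r) : IsResolventAt (generator T) r (hT.shiftedPow 1 r) := by
  have h1 : ∀ x, HasOrbitDeriv T (hT.shiftedPow 1 r x) ((r : ℂ) • hT.shiftedPow 1 r x - x) := by
    intro x
    rw [hT.shiftedPow_one_apply hr]
    exact hT.hasOrbitDeriv_laplace hr x
  refine isResolventAt_generator_iff.mpr ⟨h1, fun x y hxy => ?_⟩
  -- The left inverse property comes from the right one: the Laplace transform commutes with the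
  -- semigroup, and orbit derivatives are unique.
  have h2 := hxy.map (S := hT.shiftedPow 1 r) fun t ht => hT.shiftedPow_comm one_pos hr ht
  rw [map_sub, map_smul, h2.unique (h1 x), sub_sub_cancel]

theorem IsBoundedC0Semigroup.isResolventAt (hT : IsBoundedC0Semigroup T) {r : ℝ} (hr : 0 < r) :
    IsResolventAt (generator T) r (opResolvent (generator T) r) :=
  isResolventAt_opResolvent ⟨_, hT.isResolventAt_shiftedPow_one hr⟩

theorem IsBoundedC0Semigroup.shiftedPow_one (hT : IsBoundedC0Semigroup T) {r : ℝ} (hr : 0 < r) :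
    hT.shiftedPow 1 r = opResolvent (generator T) r :=
  ((hT.isResolventAt_shiftedPow_one hr).opResolvent_eq).symm

theorem IsBoundedC0Semigroup.norm_opResolvent_le (hT : IsBoundedC0Semigroup T) {r : ℝ}
    (hr : 0 < r) : ‖opResolvent (generator T) r‖ ≤ hT.bound / r := by
  rw [← hT.shiftedPow_one hr]
  refine (hT.norm_shiftedPow_le one_pos hr).trans_eq ?_
  rw [Real.rpow_neg_one, div_eq_inv_mul]

/-- For `y = R(1, A) x` one has `x = y - A y`. Here `y` is in the domain, and `A y` is a limit of
difference quotients that stay in the domain because it is invariant under the semigroup. -/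
theorem IsBoundedC0Semigroup.dense_domain (hT : IsBoundedC0Semigroup T) :
    Dense ((generator T).domain : Set X) := by
  intro x
  have hR := hT.isResolventAt one_pos
  set y := opResolvent (generator T) ((1 : ℝ) : ℂ) x with hy
  have hd : HasOrbitDeriv T y (((1 : ℝ) : ℂ) • y - x) := hR.hasOrbitDeriv x
  have hyD : y ∈ (generator T).domain := ⟨_, hd⟩
  have h1 : ((1 : ℝ) : ℂ) • y - x ∈ (generator T).domain.topologicalClosure := by
    refine mem_closure_of_tendsto hd ?_
    filter_upwards [self_mem_nhdsWithin] with t ht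
    refine (generator T).domain.smul_mem _ ((generator T).domain.sub_mem ?_ hyD)
    exact ⟨_, hd.map (S := T t) fun s hs => hT.comm hs (le_of_lt ht)⟩
  have h2 := (generator T).domain.topologicalClosure.sub_mem
    ((generator T).domain.topologicalClosure.smul_mem ((1 : ℝ) : ℂ)
      ((generator T).domain.le_topologicalClosure hyD)) h1
  rwa [sub_sub_cancel] at h2

end Generator

/-! ### Balakrishnan's formula and the semigroup law of `(-A)^{-s}` -/

section Balakrishnan

/-- This is the dominating function for Balakrishnan's integrals, uniform in the shift `ε`: the
constant bound serves near `0`, the bound `K / l` near infinity. -/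
theorem integrableOn_rpow_mul_min {r M K : ℝ} (hr0 : 0 < r) (hr1 : r < 1) (hM : 0 ≤ M)
    (hK : 0 ≤ K) : IntegrableOn (fun l : ℝ => l ^ (-r) * min M (K / l)) (Ioi 0) := by
  have hmeas : Measurable fun l : ℝ => l ^ (-r) * min M (K / l) := by fun_prop
  rw [← Ioc_union_Ioi_eq_Ioi zero_le_one]
  refine IntegrableOn.union ?_ ?_
  · have h1 : IntegrableOn (fun l : ℝ => l ^ (-r)) (Ioc 0 1) :=
      (intervalIntegrable_iff_integrableOn_Ioc_of_le zero_le_one).mp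
        (intervalIntegral.intervalIntegrable_rpow' (by linarith))
    refine Integrable.mono' (h1.mul_const M) hmeas.aestronglyMeasurable ?_
    filter_upwards [ae_restrict_mem measurableSet_Ioc] with l hl
    have := hl.1
    rw [Real.norm_of_nonneg (by positivity)]
    exact mul_le_mul_of_nonneg_left (min_le_left _ _) (by positivity)
  · have h1 : IntegrableOn (fun l : ℝ => l ^ (-r - 1)) (Ioi 1) :=
      integrableOn_Ioi_rpow_of_lt (by linarith) one_pos
    refine Integrable.mono' (h1.mul_const K) hmeas.aestronglyMeasurable ?_
    filter_upwards [ae_restrict_mem measurableSet_Ioi] with l hl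
    have : 0 < l := one_pos.trans hl
    rw [Real.norm_of_nonneg (by positivity), Real.rpow_sub_one this.ne', div_mul_eq_mul_div,
      ← mul_div_assoc']
    exact mul_le_mul_of_nonneg_left (min_le_right _ _) (by positivity)

theorem integral_rpow_neg_mul_exp {r t : ℝ} (hr1 : r < 1) (ht : 0 < t) :
    ∫ l in Ioi (0 : ℝ), l ^ (-r) * Real.exp (-(t * l)) = t ^ (r - 1) * Real.Gamma (1 - r) := by
  have := Real.integral_rpow_mul_exp_neg_mul_Ioi (a := 1 - r) (by linarith) ht
  rw [show (1 - r - 1 : ℝ) = -r by ring, one_div, Real.inv_rpow ht.le,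
    ← Real.rpow_neg ht.le, neg_sub] at this
  exact this

theorem integrableOn_rpow_mul_exp {a t : ℝ} (ha : -1 < a) (ht : 0 < t) :
    IntegrableOn (fun l : ℝ => l ^ a * Real.exp (-(t * l))) (Ioi 0) := by
  simpa using integrableOn_rpow_mul_exp_neg_mul_rpow (p := 1) ha one_pos ht

theorem integrable_rpow_mul_exp_mul_exp {r ε : ℝ} (hr0 : 0 < r) (hr1 : r < 1) (hε : 0 < ε) :
    Integrable (fun q : ℝ × ℝ => q.1 ^ (-r) * Real.exp (-(q.2 * q.1)) * Real.exp (-(ε * q.2)))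
      ((volume.restrict (Ioi 0)).prod (volume.restrict (Ioi 0))) := by
  have hm : Measurable
      fun q : ℝ × ℝ => q.1 ^ (-r) * Real.exp (-(q.2 * q.1)) * Real.exp (-(ε * q.2)) := by fun_prop
  rw [integrable_prod_iff' hm.aestronglyMeasurable]
  constructor
  · filter_upwards [ae_restrict_mem measurableSet_Ioi] with t ht
    exact Integrable.mul_const (integrableOn_rpow_mul_exp (by linarith) ht) _
  · refine ((integrableOn_rpow_mul_exp (a := r - 1) (by linarith) hε).const_mul
      (Real.Gamma (1 - r))).congr ?_
    filter_upwards [ae_restrict_mem measurableSet_Ioi] with t ht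
    have : ∫ l in Ioi (0 : ℝ), ‖l ^ (-r) * Real.exp (-(t * l)) * Real.exp (-(ε * t))‖ =
        ∫ l in Ioi (0 : ℝ), l ^ (-r) * Real.exp (-(t * l)) * Real.exp (-(ε * t)) := by
      refine setIntegral_congr_fun measurableSet_Ioi fun l hl => ?_
      have : 0 < l := hl
      exact Real.norm_of_nonneg (by positivity)
    rw [this, integral_mul_const, integral_rpow_neg_mul_exp hr1 ht]
    ring

variable {X : Type*} [NormedAddCommGroup X] [NormedSpace ℂ X]

theorem neg_opInverse (A : X →ₗ.[ℂ] X) : -opInverse A = opResolvent A 0 := neg_neg _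

theorem negPowNeg_zero (A : X →ₗ.[ℂ] X) : negPowNeg A 0 = 1 := by simp [negPowNeg]

theorem negPowNeg_one (A : X →ₗ.[ℂ] X) : negPowNeg A 1 = -opInverse A := by simp [negPowNeg]

variable [CompleteSpace X] {T : ℝ → X →L[ℂ] X}

theorem IsBoundedC0Semigroup.isResolventAt_of_nonneg (hT : IsBoundedC0Semigroup T)
    (h0 : (0 : ℂ) ∈ opResolventSet (generator T)) {l : ℝ} (hl : 0 ≤ l) :
    IsResolventAt (generator T) l (opResolvent (generator T) l) := by
  rcases hl.eq_or_lt with rfl | hl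
  · exact isResolventAt_opResolvent (by simpa using h0)
  · exact hT.isResolventAt hl

/-- The resolvent identity gives `R(l) = (I - l R(l)) R(0)`, and `l R(l)` is bounded by the
semigroup bound. -/
theorem IsBoundedC0Semigroup.norm_opResolvent_apply_le (hT : IsBoundedC0Semigroup T)
    (h0 : (0 : ℂ) ∈ opResolventSet (generator T)) {l : ℝ} (hl : 0 ≤ l) (y : X) :
    ‖opResolvent (generator T) l y‖ ≤
      (hT.bound + 1) * ‖opResolvent (generator T) 0 y‖ := by
  rcases hl.eq_or_lt with rfl | hl
  · rw [Complex.ofReal_zero]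
    nlinarith [hT.bound_nonneg, norm_nonneg (opResolvent (generator T) 0 y)]
  have e := DFunLike.congr_fun ((hT.isResolventAt hl).sub_eq (isResolventAt_opResolvent h0)) y
  rw [sub_apply, sub_eq_iff_eq_add, smul_apply, mul_apply_eq_comp] at e
  rw [e, add_mul, one_mul]
  refine norm_add_le_of_le ?_ le_rfl
  rw [norm_smul, zero_sub, norm_neg, Complex.norm_real, Real.norm_of_nonneg hl.le]
  calc l * _ ≤ l * (hT.bound / l * ‖opResolvent (generator T) 0 y‖) :=
        mul_le_mul_of_nonneg_left
          ((opResolvent (generator T) l).le_of_opNorm_le (hT.norm_opResolvent_le hl) _) hl.le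
    _ = _ := by field_simp

theorem IsBoundedC0Semigroup.norm_opResolvent_le_of_nonneg (hT : IsBoundedC0Semigroup T)
    (h0 : (0 : ℂ) ∈ opResolventSet (generator T)) {l : ℝ} (hl : 0 ≤ l) :
    ‖opResolvent (generator T) l‖ ≤ (hT.bound + 1) * ‖opResolvent (generator T) 0‖ := by
  have hK := hT.bound_nonneg
  refine ContinuousLinearMap.opNorm_le_bound _ (by positivity) fun y => ?_
  refine (hT.norm_opResolvent_apply_le h0 hl y).trans ?_
  rw [mul_assoc]
  exact mul_le_mul_of_nonneg_left (ContinuousLinearMap.le_opNorm _ _) (by positivity)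

theorem IsBoundedC0Semigroup.norm_opResolvent_add_le (hT : IsBoundedC0Semigroup T)
    (h0 : (0 : ℂ) ∈ opResolventSet (generator T)) {l ε : ℝ} (hl : 0 < l) (hε : 0 ≤ ε) :
    ‖opResolvent (generator T) ((l + ε : ℝ) : ℂ)‖ ≤
      min ((hT.bound + 1) * ‖opResolvent (generator T) 0‖) (hT.bound / l) := by
  refine le_min (hT.norm_opResolvent_le_of_nonneg h0 (by positivity))
    ((hT.norm_opResolvent_le (by positivity)).trans ?_)
  exact div_le_div_of_nonneg_left hT.bound_nonneg hl (by linarith)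

theorem IsBoundedC0Semigroup.continuousOn_opResolvent (hT : IsBoundedC0Semigroup T)
    (h0 : (0 : ℂ) ∈ opResolventSet (generator T)) :
    ContinuousOn (fun l : ℝ => opResolvent (generator T) (l : ℂ)) (Ici 0) := by
  have hK := hT.bound_nonneg
  set M := (hT.bound + 1) * ‖opResolvent (generator T) 0‖ with hM
  have hM0 : 0 ≤ M := by positivity
  have : LipschitzOnWith (Real.toNNReal (M * M))
      (fun l : ℝ => opResolvent (generator T) (l : ℂ)) (Ici 0) := by
    refine LipschitzOnWith.of_dist_le_mul fun l hl m hm => ?_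
    rw [Real.coe_toNNReal _ (by positivity), dist_eq_norm,
      (hT.isResolventAt_of_nonneg h0 hl).sub_eq (hT.isResolventAt_of_nonneg h0 hm), norm_smul,
      ← Complex.ofReal_sub, Complex.norm_real, ← dist_eq_norm, dist_comm, mul_comm]
    refine mul_le_mul_of_nonneg_right ((norm_mul_le _ _).trans ?_) dist_nonneg
    exact mul_le_mul (hT.norm_opResolvent_le_of_nonneg h0 hl)
      (hT.norm_opResolvent_le_of_nonneg h0 hm) (norm_nonneg _) hM0
  exact this.continuousOn

theorem IsBoundedC0Semigroup.aestronglyMeasurable_balakrishnan (hT : IsBoundedC0Semigroup T)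
    (h0 : (0 : ℂ) ∈ opResolventSet (generator T)) {ε : ℝ} (hε : 0 ≤ ε) (r : ℝ) :
    AEStronglyMeasurable
      (fun l : ℝ => (l ^ (-r)) • opResolvent (generator T) ((l + ε : ℝ) : ℂ))
      (volume.restrict (Ioi 0)) := by
  have hpow : Measurable fun l : ℝ => l ^ (-r) := by fun_prop
  refine hpow.aestronglyMeasurable.smul (ContinuousOn.aestronglyMeasurable ?_ measurableSet_Ioi)
  exact (hT.continuousOn_opResolvent h0).comp (f := fun l : ℝ => l + ε)
    (by fun_prop) fun l hl => add_nonneg (le_of_lt hl) hε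

theorem IsBoundedC0Semigroup.norm_balakrishnan_le (hT : IsBoundedC0Semigroup T)
    (h0 : (0 : ℂ) ∈ opResolventSet (generator T)) {ε : ℝ} (hε : 0 ≤ ε) (r : ℝ) :
    ∀ᵐ l : ℝ ∂volume.restrict (Ioi 0),
      ‖(l ^ (-r)) • opResolvent (generator T) ((l + ε : ℝ) : ℂ)‖ ≤
        l ^ (-r) * min ((hT.bound + 1) * ‖opResolvent (generator T) 0‖) (hT.bound / l) := by
  filter_upwards [ae_restrict_mem measurableSet_Ioi] with l hl
  have hl' : 0 < l := hl
  rw [norm_smul, Real.norm_of_nonneg (by positivity)]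
  exact mul_le_mul_of_nonneg_left (hT.norm_opResolvent_add_le h0 hl hε) (by positivity)

theorem IsBoundedC0Semigroup.integrableOn_balakrishnan (hT : IsBoundedC0Semigroup T)
    (h0 : (0 : ℂ) ∈ opResolventSet (generator T)) {ε : ℝ} (hε : 0 ≤ ε) {r : ℝ} (hr0 : 0 < r)
    (hr1 : r < 1) :
    IntegrableOn (fun l : ℝ => (l ^ (-r)) • opResolvent (generator T) ((l + ε : ℝ) : ℂ))
      (Ioi 0) := by
  have hK := hT.bound_nonneg
  exact Integrable.mono' (integrableOn_rpow_mul_min hr0 hr1 (by positivity) hK)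
    (hT.aestronglyMeasurable_balakrishnan h0 hε r) (hT.norm_balakrishnan_le h0 hε r)

/-- Write the resolvent as a Laplace transform and integrate over `l` first. The shift `ε > 0`
supplies the decay in `t` that makes Fubini applicable, as `T` is only bounded. -/
theorem IsBoundedC0Semigroup.integral_balakrishnan_apply (hT : IsBoundedC0Semigroup T)
    {ε : ℝ} (hε : 0 < ε) {r : ℝ} (hr0 : 0 < r) (hr1 : r < 1) (x : X) :
    ∫ l in Ioi (0 : ℝ), (l ^ (-r)) • opResolvent (generator T) ((l + ε : ℝ) : ℂ) x =
      Real.Gamma (1 - r) •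
        ∫ t in Ioi 0, (t ^ (r - 1) * Real.exp (-(ε * t))) • T (max t 0) x := by
  have hint : Integrable (fun q : ℝ × ℝ =>
      (q.1 ^ (-r) * Real.exp (-(q.2 * q.1)) * Real.exp (-(ε * q.2))) • T (max q.2 0) x)
      ((volume.restrict (Ioi 0)).prod (volume.restrict (Ioi 0))) := by
    exact (integrable_rpow_mul_exp_mul_exp hr0 hr1 hε).smul_bdd (hT.bound * ‖x‖)
      ((hT.continuous_orbit x).comp continuous_snd).aestronglyMeasurable
      (ae_of_all _ fun q => hT.norm_apply_le (le_max_right _ _) x)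
  calc _ = ∫ l in Ioi (0 : ℝ), ∫ t in Ioi (0 : ℝ),
        (l ^ (-r) * Real.exp (-(t * l)) * Real.exp (-(ε * t))) • T (max t 0) x := by
        refine setIntegral_congr_fun measurableSet_Ioi fun l hl => ?_
        have hl' : 0 < l := hl
        rw [← hT.shiftedPow_one (by positivity), hT.shiftedPow_one_apply (by positivity),
          ← integral_smul]
        refine integral_congr_ae (ae_of_all _ fun t => ?_)
        beta_reduce
        rw [smul_smul, mul_assoc, ← Real.exp_add]
        ring_nf
    _ = ∫ t in Ioi (0 : ℝ), ∫ l in Ioi (0 : ℝ),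
        (l ^ (-r) * Real.exp (-(t * l)) * Real.exp (-(ε * t))) • T (max t 0) x :=
        integral_integral_swap hint
    _ = _ := by
        rw [← integral_smul]
        refine setIntegral_congr_fun measurableSet_Ioi fun t ht => ?_
        rw [integral_smul_const, integral_mul_const, integral_rpow_neg_mul_exp hr1 ht, smul_smul]
        ring_nf

/-- Balakrishnan's formula for the fractional powers of `ε I - A`. -/
theorem IsBoundedC0Semigroup.shiftedPow_eq_balakrishnan (hT : IsBoundedC0Semigroup T)
    (h0 : (0 : ℂ) ∈ opResolventSet (generator T))
    {ε : ℝ} (hε : 0 < ε) {r : ℝ} (hr0 : 0 < r) (hr1 : r < 1) :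
    hT.shiftedPow r ε = (Real.sin (Real.pi * r) / Real.pi) •
      ∫ l in Ioi (0 : ℝ), (l ^ (-r)) • opResolvent (generator T) ((l + ε : ℝ) : ℂ) := by
  ext x
  rw [hT.shiftedPow_apply hr0 hε, smul_apply,
    ContinuousLinearMap.integral_apply (hT.integrableOn_balakrishnan h0 hε.le hr0 hr1)]
  simp only [smul_apply]
  rw [hT.integral_balakrishnan_apply hε hr0 hr1, smul_smul]
  congr 1
  -- Euler's reflection formula turns `Γ(r)⁻¹` into the constant `sin (π r) / π` times `Γ(1 - r)`.
  have h := Real.Gamma_mul_Gamma_one_sub r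
  have h1 := Real.Gamma_pos_of_pos hr0
  have hsin : 0 < Real.sin (Real.pi * r) :=
    Real.sin_pos_of_pos_of_lt_pi (by positivity) (by nlinarith [Real.pi_pos])
  have hπ := Real.pi_pos
  rw [eq_div_iff hsin.ne'] at h
  field_simp
  linarith

theorem IsBoundedC0Semigroup.tendsto_balakrishnan (hT : IsBoundedC0Semigroup T)
    (h0 : (0 : ℂ) ∈ opResolventSet (generator T)) {r : ℝ} (hr0 : 0 < r) (hr1 : r < 1) :
    Tendsto (fun ε : ℝ => ∫ l in Ioi (0 : ℝ),
        (l ^ (-r)) • opResolvent (generator T) ((l + ε : ℝ) : ℂ)) (𝓝[>] 0)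
      (𝓝 (∫ l in Ioi (0 : ℝ), (l ^ (-r)) • opResolvent (generator T) (l : ℂ))) := by
  have hK := hT.bound_nonneg
  refine tendsto_integral_filter_of_dominated_convergence _ ?_ ?_
    (integrableOn_rpow_mul_min (M := (hT.bound + 1) * ‖opResolvent (generator T) 0‖) hr0 hr1
      (by positivity) hK) ?_
  · filter_upwards [self_mem_nhdsWithin] with ε hε
    exact hT.aestronglyMeasurable_balakrishnan h0 (le_of_lt hε) r
  · filter_upwards [self_mem_nhdsWithin] with ε hε
    exact hT.norm_balakrishnan_le h0 (le_of_lt hε) r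
  · filter_upwards [ae_restrict_mem measurableSet_Ioi] with l hl
    refine Tendsto.const_smul ?_ _
    have hc := (hT.continuousOn_opResolvent h0).continuousAt (Ici_mem_nhds hl)
    refine Tendsto.comp (f := fun ε : ℝ => l + ε) hc (Tendsto.mono_left ?_ nhdsWithin_le_nhds)
    exact (continuous_const.add continuous_id).tendsto' 0 l (add_zero l)

theorem IsBoundedC0Semigroup.shiftedPow_add_nat (hT : IsBoundedC0Semigroup T) {a ε : ℝ}
    (ha : 0 < a) (hε : 0 < ε) (n : ℕ) :
    hT.shiftedPow (a + n) ε = opResolvent (generator T) ε ^ n * hT.shiftedPow a ε := by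
  induction n with
  | zero => simp
  | succ n ih =>
    rw [Nat.cast_succ, show a + ((n : ℝ) + 1) = 1 + (a + n) by ring,
      hT.shiftedPow_add one_pos (by positivity) hε, ih, hT.shiftedPow_one hε, pow_succ', mul_assoc]

/-- The fractional powers `(ε I - A)^{-s}` converge to `(-A)^{-s}` as `ε ↓ 0`. -/
theorem IsBoundedC0Semigroup.tendsto_shiftedPow (hT : IsBoundedC0Semigroup T)
    (h0 : (0 : ℂ) ∈ opResolventSet (generator T)) {s : ℝ} (hs : 0 < s) :
    Tendsto (fun ε => hT.shiftedPow s ε) (𝓝[>] 0) (𝓝 (negPowNeg (generator T) s)) := by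
  have hR : Tendsto (fun ε : ℝ => opResolvent (generator T) (ε : ℂ)) (𝓝[>] 0)
      (𝓝 (-opInverse (generator T))) := by
    rw [neg_opInverse]
    have := ((hT.continuousOn_opResolvent h0) 0 self_mem_Ici).mono_left
      (nhdsWithin_mono 0 Ioi_subset_Ici_self)
    simpa using this
  have hfl : (⌊s⌋₊ : ℝ) + Int.fract s = s := by
    rw [natCast_floor_eq_intCast_floor hs.le, Int.floor_add_fract]
  rw [negPowNeg]
  split_ifs with hf
  · rw [hf, add_zero] at hfl
    -- `shiftedPow` takes the default value `0` at exponent `0`, so an integer `s` is written as `1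
    -- + n` and the induction starts at the resolvent.
    have hn : ⌊s⌋₊ ≠ 0 := fun h => by rw [h] at hfl; simp at hfl; exact hs.ne hfl
    obtain ⟨n, hn⟩ := Nat.exists_eq_succ_of_ne_zero hn
    rw [mul_one]
    refine (hR.pow ⌊s⌋₊).congr' ?_
    filter_upwards [self_mem_nhdsWithin] with ε hε
    have e : s = 1 + n := by rw [← hfl, hn]; push_cast; ring
    nth_rw 2 [e]
    rw [hT.shiftedPow_add_nat one_pos hε, hT.shiftedPow_one hε, hn, pow_succ]
  · have hr0 : 0 < Int.fract s := lt_of_le_of_ne (Int.fract_nonneg s) (Ne.symm hf)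
    have hr1 := Int.fract_lt_one s
    refine ((hR.pow ⌊s⌋₊).mul ((hT.tendsto_balakrishnan h0 hr0 hr1).const_smul
      (Real.sin (Real.pi * Int.fract s) / Real.pi))).congr' ?_
    filter_upwards [self_mem_nhdsWithin] with ε hε
    rw [← hT.shiftedPow_eq_balakrishnan h0 hε hr0 hr1, ← hT.shiftedPow_add_nat hr0 hε,
      add_comm, hfl]

/-- The semigroup law of the fractional powers. -/
theorem IsBoundedC0Semigroup.negPowNeg_add (hT : IsBoundedC0Semigroup T)
    (h0 : (0 : ℂ) ∈ opResolventSet (generator T)) {s u : ℝ} (hs : 0 ≤ s) (hu : 0 ≤ u) :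
    negPowNeg (generator T) (s + u) =
      negPowNeg (generator T) s * negPowNeg (generator T) u := by
  rcases hs.eq_or_lt with rfl | hs
  · rw [zero_add, negPowNeg_zero, one_mul]
  rcases hu.eq_or_lt with rfl | hu
  · rw [add_zero, negPowNeg_zero, mul_one]
  refine tendsto_nhds_unique (hT.tendsto_shiftedPow h0 (add_pos hs hu))
    (((hT.tendsto_shiftedPow h0 hs).mul (hT.tendsto_shiftedPow h0 hu)).congr' ?_)
  filter_upwards [self_mem_nhdsWithin] with ε hε
  rw [hT.shiftedPow_add hs hu hε]

theorem IsBoundedC0Semigroup.negPowNeg_pow (hT : IsBoundedC0Semigroup T)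
    (h0 : (0 : ℂ) ∈ opResolventSet (generator T)) {s : ℝ} (hs : 0 ≤ s) (n : ℕ) :
    negPowNeg (generator T) s ^ n = negPowNeg (generator T) (n * s) := by
  induction n with
  | zero => rw [pow_zero, Nat.cast_zero, zero_mul, negPowNeg_zero]
  | succ n ih =>
    rw [pow_succ, ih, ← hT.negPowNeg_add h0 (by positivity) hs, Nat.cast_succ, add_one_mul]

theorem IsBoundedC0Semigroup.commute_negPowNeg (hT : IsBoundedC0Semigroup T)
    (h0 : (0 : ℂ) ∈ opResolventSet (generator T)) {s t : ℝ} (hs : 0 ≤ s) (ht : 0 ≤ t) :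
    Commute (T t) (negPowNeg (generator T) s) := by
  rcases hs.eq_or_lt with rfl | hs
  · rw [negPowNeg_zero]; exact Commute.one_right _
  have hl := hT.tendsto_shiftedPow h0 hs
  refine tendsto_nhds_unique (hl.const_mul (T t)) ((hl.mul_const (T t)).congr' ?_)
  filter_upwards [self_mem_nhdsWithin] with ε hε
  exact (hT.shiftedPow_comm hs hε ht).eq.symm

end Balakrishnan

/-! ### Moment inequalities for fractional powers -/

section Moment

variable {X : Type*} [NormedAddCommGroup X] [NormedSpace ℂ X]

/-- The interpolation inequality `‖C y‖ ≤ c ‖D y‖^θ ‖y‖^{1-θ}`. -/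
def MomentBound (C D : X →L[ℂ] X) (θ : ℝ) : Prop :=
  ∃ c : ℝ, 0 ≤ c ∧ ∀ y, ‖C y‖ ≤ c * ‖D y‖ ^ θ * ‖y‖ ^ (1 - θ)

theorem MomentBound.refl (C : X →L[ℂ] X) : MomentBound C C 1 :=
  ⟨1, zero_le_one, fun y => by simp⟩

theorem MomentBound.trans {C D E : X →L[ℂ] X} {θ η : ℝ} (h : MomentBound C D θ)
    (h' : MomentBound D E η) (hθ0 : 0 ≤ θ) (hθ1 : θ ≤ 1) (hη1 : η ≤ 1) :
    MomentBound C E (η * θ) := by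
  obtain ⟨c, hc, H⟩ := h
  obtain ⟨c', hc', H'⟩ := h'
  refine ⟨c * c' ^ θ, by positivity, fun y => (H y).trans ?_⟩
  have e : 1 - η * θ = (1 - η) * θ + (1 - θ) := by ring
  rw [e, Real.rpow_add_of_nonneg (norm_nonneg y) (mul_nonneg (by linarith) hθ0) (by linarith),
    Real.rpow_mul (norm_nonneg _), Real.rpow_mul (norm_nonneg _), ← mul_assoc]
  refine mul_le_mul_of_nonneg_right ?_ (by positivity)
  rw [mul_assoc c, mul_assoc c]
  refine mul_le_mul_of_nonneg_left ?_ hc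
  rw [← Real.mul_rpow (by positivity) (by positivity),
    ← Real.mul_rpow (by positivity) (by positivity)]
  exact Real.rpow_le_rpow (norm_nonneg _) (H' y) hθ0

/-- The hypothesis is log-convexity of `k ↦ ‖D^k y‖` up to constants. Inductively, raise it to the
power `m + 1`, use the induction hypothesis at `D y`, and cancel `‖D y‖ ^ m`. -/
theorem norm_apply_pow_le_of_sq_le {D : X →L[ℂ] X} {c : ℝ} (hc : 0 ≤ c)
    (h : ∀ y, ‖D y‖ ^ 2 ≤ c * ‖D (D y)‖ * ‖y‖) (m : ℕ) :
    ∃ c' : ℝ, 0 ≤ c' ∧ ∀ y, ‖D y‖ ^ (m + 1) ≤ c' * ‖(D ^ (m + 1)) y‖ * ‖y‖ ^ m := by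
  induction m with
  | zero => exact ⟨1, zero_le_one, fun y => by simp⟩
  | succ m ih =>
    obtain ⟨c', hc', H⟩ := ih
    refine ⟨c ^ (m + 1) * c', by positivity, fun y => ?_⟩
    rcases (norm_nonneg (D y)).eq_or_lt with h0 | h0
    · rw [← h0, zero_pow (by positivity)]
      positivity
    refine le_of_mul_le_mul_right ?_ (pow_pos h0 m)
    have e : (D ^ (m + 1)) (D y) = (D ^ (m + 1 + 1)) y := by rw [pow_succ]; rfl
    calc ‖D y‖ ^ (m + 1 + 1) * ‖D y‖ ^ m = (‖D y‖ ^ 2) ^ (m + 1) := by ring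
      _ ≤ (c * ‖D (D y)‖ * ‖y‖) ^ (m + 1) := pow_le_pow_left₀ (by positivity) (h y) _
      _ = c ^ (m + 1) * ‖y‖ ^ (m + 1) * ‖D (D y)‖ ^ (m + 1) := by ring
      _ ≤ c ^ (m + 1) * ‖y‖ ^ (m + 1) * (c' * ‖(D ^ (m + 1)) (D y)‖ * ‖D y‖ ^ m) :=
        mul_le_mul_of_nonneg_left (H (D y)) (by positivity)
      _ = _ := by rw [e]; ring

theorem MomentBound.pow {D : X →L[ℂ] X} (h : MomentBound D (D * D) (1 / 2)) {m : ℕ}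
    (hm : m ≠ 0) : MomentBound D (D ^ m) (1 / m) := by
  obtain ⟨n, rfl⟩ := Nat.exists_eq_succ_of_ne_zero hm
  obtain ⟨c, hc, H⟩ := h
  have hsq : ∀ y, ‖D y‖ ^ 2 ≤ c ^ 2 * ‖D (D y)‖ * ‖y‖ := by
    intro y
    refine (pow_le_pow_left₀ (norm_nonneg _) (H y) 2).trans_eq ?_
    rw [mul_pow, mul_pow, ← Real.rpow_mul_natCast (norm_nonneg _),
      ← Real.rpow_mul_natCast (norm_nonneg _), mul_apply_eq_comp]
    norm_num
  obtain ⟨c', hc', H'⟩ := norm_apply_pow_le_of_sq_le (sq_nonneg c) hsq n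
  refine ⟨c' ^ (1 / ((n.succ : ℕ) : ℝ)), by positivity, fun y => ?_⟩
  have hn : (0 : ℝ) < n.succ := by positivity
  have h1 := Real.rpow_le_rpow (by positivity) (H' y) (one_div_nonneg.mpr hn.le)
  rw [← Real.rpow_natCast, ← Real.rpow_mul (norm_nonneg _), mul_one_div_cancel hn.ne',
    Real.rpow_one, Real.mul_rpow (by positivity) (by positivity),
    Real.mul_rpow (by positivity) (by positivity), ← Real.rpow_natCast,
    ← Real.rpow_mul (norm_nonneg _)] at h1
  refine h1.trans_eq ?_
  congr 2
  rw [Nat.cast_succ]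
  have : (n : ℝ) + 1 ≠ 0 := by positivity
  field_simp
  ring

variable [CompleteSpace X] {T : ℝ → X →L[ℂ] X}

/-- Split at a free level `N`: below it the resolvent is controlled by `R(0) y`, above it by `‖y‖ /
l`. -/
theorem IsBoundedC0Semigroup.norm_integral_balakrishnan_le (hT : IsBoundedC0Semigroup T)
    (h0 : (0 : ℂ) ∈ opResolventSet (generator T)) {r : ℝ} (hr0 : 0 < r) (hr1 : r < 1)
    {N : ℝ} (hN : 0 < N) (y : X) :
    ‖∫ l in Ioi (0 : ℝ), (l ^ (-r)) • opResolvent (generator T) (l : ℂ) y‖ ≤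
      N ^ (1 - r) / (1 - r) * ((hT.bound + 1) * ‖opResolvent (generator T) 0 y‖) +
        N ^ (-r) / r * (hT.bound * ‖y‖) := by
  have hint : IntegrableOn
      (fun l : ℝ => (l ^ (-r)) • opResolvent (generator T) (l : ℂ) y) (Ioi 0) := by
    have := (hT.integrableOn_balakrishnan h0 le_rfl hr0 hr1).apply_continuousLinearMap y
    simpa [IntegrableOn] using this
  have hu := Ioc_union_Ioi_eq_Ioi hN.le
  rw [← hu] at hint ⊢
  rw [setIntegral_union (Ioc_disjoint_Ioi le_rfl) measurableSet_Ioi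
    (hint.mono_set subset_union_left) (hint.mono_set subset_union_right)]
  refine norm_add_le_of_le ?_ ?_
  · have h1 : IntegrableOn (fun l : ℝ => l ^ (-r)) (Ioc 0 N) :=
      (intervalIntegrable_iff_integrableOn_Ioc_of_le hN.le).mp
        (intervalIntegral.intervalIntegrable_rpow' (by linarith))
    have e : ∫ l in Ioc 0 N, l ^ (-r) * ((hT.bound + 1) * ‖opResolvent (generator T) 0 y‖) =
        N ^ (1 - r) / (1 - r) * ((hT.bound + 1) * ‖opResolvent (generator T) 0 y‖) := by
      rw [integral_mul_const, ← intervalIntegral.integral_of_le hN.le,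
        integral_rpow (Or.inl (by linarith)), Real.zero_rpow (by linarith), neg_add_eq_sub,
        sub_zero]
    rw [← e]
    refine norm_integral_le_of_norm_le (h1.mul_const _) ?_
    filter_upwards [ae_restrict_mem measurableSet_Ioc] with l hl
    have := hl.1
    rw [norm_smul, Real.norm_of_nonneg (by positivity)]
    exact mul_le_mul_of_nonneg_left (hT.norm_opResolvent_apply_le h0 hl.1.le y) (by positivity)
  · have h1 : IntegrableOn (fun l : ℝ => l ^ (-r - 1)) (Ioi N) :=
      integrableOn_Ioi_rpow_of_lt (by linarith) hN
    have e : ∫ l in Ioi N, l ^ (-r - 1) * (hT.bound * ‖y‖) =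
        N ^ (-r) / r * (hT.bound * ‖y‖) := by
      rw [integral_mul_const, integral_Ioi_rpow_of_lt (by linarith) hN, sub_add_cancel,
        neg_div_neg_eq]
    rw [← e]
    refine norm_integral_le_of_norm_le (h1.mul_const _) ?_
    filter_upwards [ae_restrict_mem measurableSet_Ioi] with l hl
    have hl' : 0 < l := hN.trans hl
    rw [norm_smul, Real.norm_of_nonneg (by positivity), Real.rpow_sub_one hl'.ne',
      div_mul_eq_mul_div, ← mul_div_assoc', ← div_mul_eq_mul_div]
    exact mul_le_mul_of_nonneg_left
      ((opResolvent (generator T) l).le_of_opNorm_le (hT.norm_opResolvent_le hl') y)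
      (by positivity)

theorem IsBoundedC0Semigroup.negPowNeg_apply (hT : IsBoundedC0Semigroup T)
    (h0 : (0 : ℂ) ∈ opResolventSet (generator T)) {r : ℝ} (hr0 : 0 < r) (hr1 : r < 1) (y : X) :
    negPowNeg (generator T) r y = (Real.sin (Real.pi * r) / Real.pi) •
      ∫ l in Ioi (0 : ℝ), (l ^ (-r)) • opResolvent (generator T) (l : ℂ) y := by
  have hfl : ⌊r⌋₊ = 0 := Nat.floor_eq_zero.mpr hr1
  have hfr : Int.fract r = r := Int.fract_eq_self.mpr ⟨hr0.le, hr1⟩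
  have hint := hT.integrableOn_balakrishnan h0 le_rfl hr0 hr1
  simp only [add_zero] at hint
  rw [negPowNeg, hfl, hfr, if_neg hr0.ne', pow_zero, one_mul, smul_apply,
    ContinuousLinearMap.integral_apply hint]
  rfl

/-- The moment inequality between `I`, `(-A)^{-r}` and `(-A)^{-1}`. -/
theorem IsBoundedC0Semigroup.momentBound_one (hT : IsBoundedC0Semigroup T)
    (h0 : (0 : ℂ) ∈ opResolventSet (generator T)) {r : ℝ} (hr0 : 0 < r) (hr1 : r < 1) :
    MomentBound (negPowNeg (generator T) r) (negPowNeg (generator T) 1) r := by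
  have hK := hT.bound_nonneg
  have hr1' : 0 < 1 - r := by linarith
  rw [negPowNeg_one, neg_opInverse]
  refine ⟨|Real.sin (Real.pi * r) / Real.pi| * ((hT.bound + 1) / (1 - r) + hT.bound / r),
    by positivity, fun y => ?_⟩
  rw [hT.negPowNeg_apply h0 hr0 hr1, norm_smul, Real.norm_eq_abs, mul_assoc, mul_assoc]
  refine mul_le_mul_of_nonneg_left ?_ (abs_nonneg _)
  rcases (norm_nonneg (opResolvent (generator T) 0 y)).eq_or_lt with hb | hb
  -- If `R(0) y = 0`, then every `R(l) y` vanishes, so the balancing level below is not needed.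
  · have : ∫ l in Ioi (0 : ℝ), (l ^ (-r)) • opResolvent (generator T) (l : ℂ) y = 0 := by
      refine (setIntegral_congr_fun measurableSet_Ioi fun l hl => ?_).trans (integral_zero _ _)
      have := hT.norm_opResolvent_apply_le h0 (le_of_lt hl) y
      rw [← hb, mul_zero, norm_le_zero_iff] at this
      simp [this]
    rw [this, norm_zero]
    positivity
  have hy : 0 < ‖y‖ := by
    rw [norm_pos_iff] at hb ⊢
    rintro rfl
    exact hb (map_zero _)
  -- The level `N = ‖y‖ / ‖R(0) y‖` makes both pieces multiples of `‖R(0) y‖ ^ r * ‖y‖ ^ (1 - r)`.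
  refine (hT.norm_integral_balakrishnan_le h0 hr0 hr1 (div_pos hy hb) y).trans_eq ?_
  rw [Real.div_rpow hy.le hb.le, Real.div_rpow hy.le hb.le, Real.rpow_neg hy.le,
    Real.rpow_neg hb.le, Real.rpow_sub hy, Real.rpow_sub hb, Real.rpow_one, Real.rpow_one]
  field_simp

/-- The unknown `b` recurs on the right with exponent `r² < 1`, so it can be absorbed; then take the
root of order `1 - r² = (1 - r)(1 + r)`. -/
theorem rpow_interpolation {b c d n r : ℝ} (hb : 0 < b) (hc : 0 ≤ c) (hd : 0 ≤ d) (hn : 0 ≤ n)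
    (hr0 : 0 < r) (hr1 : r < 1) (h : b ≤ c * d ^ (1 - r) * b ^ (r * r) * n ^ ((1 - r) * r)) :
    b ≤ c ^ (1 / (1 - r * r)) * d ^ (1 / (1 + r)) * n ^ (1 - 1 / (1 + r)) := by
  have hrr : 0 < 1 - r * r := by nlinarith
  have h1 : b ^ (1 - r * r) ≤ c * d ^ (1 - r) * n ^ ((1 - r) * r) := by
    rw [Real.rpow_sub hb, Real.rpow_one, div_le_iff₀ (by positivity)]
    linarith
  have h2 := Real.rpow_le_rpow (by positivity) h1 (one_div_nonneg.mpr hrr.le)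
  rw [← Real.rpow_mul hb.le, mul_one_div_cancel hrr.ne', Real.rpow_one,
    Real.mul_rpow (by positivity) (by positivity), Real.mul_rpow hc (by positivity),
    ← Real.rpow_mul hd, ← Real.rpow_mul hn] at h2
  have hf : 1 - r * r = (1 - r) * (1 + r) := by ring
  have hr1' : 1 - r ≠ 0 := by linarith
  have e1 : (1 - r) * (1 / (1 - r * r)) = 1 / (1 + r) := by rw [hf]; field_simp
  have e2 : (1 - r) * r * (1 / (1 - r * r)) = 1 - 1 / (1 + r) := by rw [hf]; field_simp; ring
  rwa [e1, e2] at h2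

/-- The moment inequality between `I`, `(-A)^{-1}` and `(-A)^{-β}`, for `1 ≤ β < 2`. -/
theorem IsBoundedC0Semigroup.momentBound_of_one_le (hT : IsBoundedC0Semigroup T)
    (h0 : (0 : ℂ) ∈ opResolventSet (generator T)) {β : ℝ} (hβ1 : 1 ≤ β) (hβ2 : β < 2) :
    MomentBound (negPowNeg (generator T) 1) (negPowNeg (generator T) β) (1 / β) := by
  rcases hβ1.eq_or_lt with rfl | hβ
  · simpa using MomentBound.refl (negPowNeg (generator T) 1)
  obtain ⟨r, rfl⟩ : ∃ r, β = 1 + r := ⟨β - 1, by ring⟩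
  have hr0 : 0 < r := by linarith
  have hr1 : r < 1 := by linarith
  have hr1' : 0 ≤ 1 - r := by linarith
  obtain ⟨c, hc, H⟩ := hT.momentBound_one h0 hr0 hr1
  obtain ⟨c', hc', H'⟩ := hT.momentBound_one h0 (r := 1 - r) (by linarith) (by linarith)
  refine ⟨(c' * c ^ r) ^ (1 / (1 - r * r)), by positivity, fun y => ?_⟩
  rcases (norm_nonneg (negPowNeg (generator T) 1 y)).eq_or_lt with hb | hb
  · rw [← hb]
    positivity
  refine rpow_interpolation hb (by positivity) (norm_nonneg _) (norm_nonneg _) hr0 hr1 ?_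
  have e1 := hT.negPowNeg_add h0 (s := 1 - r) (u := r) (by linarith) hr0.le
  rw [sub_add_cancel] at e1
  have e2 := hT.negPowNeg_add h0 (s := 1) (u := r) zero_le_one hr0.le
  -- Factor `(-A)^{-1}` as `(-A)^{-(1-r)} (-A)^{-r}` and interpolate the first factor. The resulting
  -- `‖(-A)^{-r} y‖ ^ r` is interpolated again by `H`, which brings back `‖(-A)^{-1} y‖`.
  have h1 := H' (negPowNeg (generator T) r y)
  rw [← mul_apply_eq_comp, ← mul_apply_eq_comp, ← e1, ← e2, sub_sub_cancel] at h1
  refine h1.trans ?_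
  have h2 := Real.rpow_le_rpow (norm_nonneg _) (H y) hr0.le
  rw [Real.mul_rpow (by positivity) (by positivity), Real.mul_rpow (by positivity) (by positivity),
    ← Real.rpow_mul (norm_nonneg _), ← Real.rpow_mul (norm_nonneg _)] at h2
  refine (mul_le_mul_of_nonneg_left h2 (by positivity)).trans_eq ?_
  ring

/-- The two basic inequalities are chained through `(-A)^{-1}`, which requires `δ < 1 ≤ 2 δ`. -/
theorem IsBoundedC0Semigroup.momentBound_half (hT : IsBoundedC0Semigroup T)
    (h0 : (0 : ℂ) ∈ opResolventSet (generator T)) {δ : ℝ} (hδ1 : 1 / 2 ≤ δ) (hδ2 : δ < 1) :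
    MomentBound (negPowNeg (generator T) δ)
      (negPowNeg (generator T) δ * negPowNeg (generator T) δ) (1 / 2) := by
  have hδ : 0 < δ := by linarith
  rw [← hT.negPowNeg_add h0 hδ.le hδ.le]
  have h := (hT.momentBound_one h0 hδ hδ2).trans
    (hT.momentBound_of_one_le h0 (β := δ + δ) (by linarith) (by linarith)) hδ.le hδ2.le
    (by rw [div_le_one (by linarith)]; linarith)
  rwa [show 1 / (δ + δ) * δ = 1 / 2 by field_simp; ring] at h

end Moment

/-! ### Calculus of polynomial decay rates -/

section Decay

variable {X : Type*} [NormedAddCommGroup X] [NormedSpace ℂ X] {T : ℝ → X →L[ℂ] X}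

/-- Polynomial decay of `‖T(t) C‖` with rate `t^{-b}`. -/
def PolyDecay (T : ℝ → X →L[ℂ] X) (C : X →L[ℂ] X) (b : ℝ) : Prop :=
  ∃ c : ℝ, 0 ≤ c ∧ ∀ t : ℝ, 0 < t → ‖T t * C‖ ≤ c * t ^ (-b)

theorem IsBoundedC0Semigroup.polyDecay_one (hT : IsBoundedC0Semigroup T) : PolyDecay T 1 0 :=
  ⟨hT.bound, hT.bound_nonneg, fun t ht => by simpa using hT.norm_le ht.le⟩

theorem PolyDecay.mul (hT : IsC0Semigroup T) {C D : X →L[ℂ] X} {b d : ℝ}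
    (hC : PolyDecay T C b) (hD : PolyDecay T D d) (hcomm : ∀ t : ℝ, 0 ≤ t → Commute (T t) C) :
    PolyDecay T (C * D) (b + d) := by
  obtain ⟨c, hc, H⟩ := hC
  obtain ⟨c', hc', H'⟩ := hD
  refine ⟨c * c' * 2 ^ (b + d), by positivity, fun t ht => ?_⟩
  have ht2 : 0 < t / 2 := by positivity
  have e : T t * (C * D) = (T (t / 2) * C) * (T (t / 2) * D) := by
    have h1 : T t = T (t / 2) * T (t / 2) := by
      rw [← add_halves t, hT.map_add _ _ (by linarith) (by linarith), add_halves]; rfl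
    calc T t * (C * D) = T (t / 2) * (T (t / 2) * C) * D := by rw [h1]; simp only [mul_assoc]
      _ = T (t / 2) * (C * T (t / 2)) * D := by rw [(hcomm _ ht2.le).eq]
      _ = _ := by simp only [mul_assoc]
  rw [e]
  refine (norm_mul_le _ _).trans ((mul_le_mul (H _ ht2) (H' _ ht2) (norm_nonneg _)
    (by positivity)).trans_eq ?_)
  rw [mul_mul_mul_comm, ← Real.rpow_add ht2, ← neg_add, Real.div_rpow ht.le zero_le_two,
    Real.rpow_neg zero_le_two, div_inv_eq_mul]
  ring

theorem PolyDecay.pow (hT : IsBoundedC0Semigroup T) {C : X →L[ℂ] X} {b : ℝ}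
    (hC : PolyDecay T C b) (hcomm : ∀ t : ℝ, 0 ≤ t → Commute (T t) C) (n : ℕ) :
    PolyDecay T (C ^ n) (n * b) := by
  induction n with
  | zero => simpa using hT.polyDecay_one
  | succ n ih =>
    rw [pow_succ', Nat.cast_succ, add_one_mul, add_comm]
    exact hC.mul hT.toIsC0Semigroup ih hcomm

/-- Apply the moment inequality along the orbit: the `D` factor decays, and the remaining factor is
controlled by boundedness of the semigroup. -/
theorem PolyDecay.interpolate (hT : IsBoundedC0Semigroup T) {C D : X →L[ℂ] X} {b θ : ℝ}
    (hD : PolyDecay T D b) (h : MomentBound C D θ) (hθ0 : 0 ≤ θ) (hθ1 : θ ≤ 1)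
    (hcommC : ∀ t : ℝ, 0 ≤ t → Commute (T t) C) (hcommD : ∀ t : ℝ, 0 ≤ t → Commute (T t) D) :
    PolyDecay T C (b * θ) := by
  obtain ⟨c, hc, H⟩ := h
  obtain ⟨c', hc', H'⟩ := hD
  have hK := hT.bound_nonneg
  refine ⟨c * c' ^ θ * hT.bound ^ (1 - θ), by positivity, fun t ht => ?_⟩
  refine ContinuousLinearMap.opNorm_le_bound _ (by positivity) fun x => ?_
  rw [(hcommC t ht.le).eq, mul_apply_eq_comp]
  refine (H (T t x)).trans ?_
  have h1 : ‖D (T t x)‖ ≤ c' * t ^ (-b) * ‖x‖ := by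
    rw [← mul_apply_eq_comp, ← (hcommD t ht.le).eq]
    exact (T t * D).le_of_opNorm_le (H' t ht) x
  have h2 := Real.rpow_le_rpow (norm_nonneg _) h1 hθ0
  have h3 := Real.rpow_le_rpow (norm_nonneg _) (hT.norm_apply_le ht.le x) (sub_nonneg.mpr hθ1)
  refine (mul_le_mul (mul_le_mul_of_nonneg_left h2 hc) h3 (by positivity)
    (by positivity)).trans_eq ?_
  have hx : ‖x‖ = ‖x‖ ^ θ * ‖x‖ ^ (1 - θ) := by
    rw [← Real.rpow_add_of_nonneg (norm_nonneg _) hθ0 (by linarith), add_sub_cancel, Real.rpow_one]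
  nth_rw 3 [hx]
  rw [Real.mul_rpow (by positivity) (by positivity), Real.mul_rpow hc' (by positivity),
    Real.mul_rpow hK (by positivity), ← Real.rpow_mul ht.le, neg_mul]
  ring

end Decay

/-! ### Admissibility versus decay, and transfer of decay between exponents -/

section Admissibility

variable {X : Type*} [NormedAddCommGroup X] [NormedSpace ℂ X] {T : ℝ → X →L[ℂ] X}

theorem norm_mul_negPowNeg_one (A : X →ₗ.[ℂ] X) (S : X →L[ℂ] X) :
    ‖S * negPowNeg A 1‖ = ‖S.comp (opInverse A)‖ := by
  rw [negPowNeg_one, mul_neg, norm_neg]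
  rfl

theorem PolyDecay.isBigO {b : ℝ} (h : PolyDecay T (negPowNeg (generator T) 1) b) :
    (fun t : ℝ => ‖(T t).comp (opInverse (generator T))‖) =O[atTop] fun t : ℝ => t ^ (-b) := by
  obtain ⟨c, -, H⟩ := h
  refine IsBigO.of_bound c ?_
  filter_upwards [eventually_gt_atTop 0] with t ht
  rw [norm_norm, Real.norm_of_nonneg (by positivity), ← norm_mul_negPowNeg_one]
  exact H t ht

theorem IsBoundedC0Semigroup.polyDecay_of_isBigO (hT : IsBoundedC0Semigroup T) {b : ℝ}
    (hb : 0 ≤ b)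
    (h : (fun t : ℝ => ‖(T t).comp (opInverse (generator T))‖) =O[atTop]
      fun t : ℝ => t ^ (-b)) : PolyDecay T (negPowNeg (generator T) 1) b := by
  obtain ⟨c, hc, H⟩ := h.exists_nonneg
  obtain ⟨t₀, ht₀⟩ := eventually_atTop.mp H.bound
  have hK := hT.bound_nonneg
  set m := max t₀ 1 with hm
  have hm0 : 0 < m := by positivity
  -- The second summand covers `t < t₀`, where only boundedness is available: there `m ^ b * t ^
  -- (-b) ≥ 1`.
  refine ⟨c + hT.bound * ‖negPowNeg (generator T) 1‖ * m ^ b, by positivity, fun t ht => ?_⟩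
  rcases le_or_gt t₀ t with h1 | h1
  · have := ht₀ t h1
    rw [norm_norm, Real.norm_of_nonneg (by positivity), ← norm_mul_negPowNeg_one] at this
    refine this.trans (mul_le_mul_of_nonneg_right ?_ (by positivity))
    exact le_add_of_nonneg_right (by positivity)
  · have h2 : 1 ≤ m ^ b * t ^ (-b) := by
      rw [Real.rpow_neg ht.le, ← div_eq_mul_inv, one_le_div (by positivity)]
      exact Real.rpow_le_rpow ht.le (h1.le.trans (le_max_left _ _)) hb
    calc _ ≤ hT.bound * ‖negPowNeg (generator T) 1‖ :=
          (norm_mul_le _ _).trans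
            (mul_le_mul_of_nonneg_right (hT.norm_le ht.le) (norm_nonneg _))
      _ ≤ hT.bound * ‖negPowNeg (generator T) 1‖ * (m ^ b * t ^ (-b)) :=
          le_mul_of_one_le_right (by positivity) h2
      _ ≤ _ := by
          rw [← mul_assoc]
          exact mul_le_mul_of_nonneg_right (le_add_of_nonneg_left hc) (by positivity)

/-- Up to the semigroup bound, `‖C T(t) x‖` is dominated by its values at all earlier times `s`,
since `T(t - s)` can be moved to the left of `C`. Integrate over `s ∈ (0, t]`. -/
theorem IsBoundedC0Semigroup.norm_rpow_le_of_admissible (hT : IsBoundedC0Semigroup T)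
    {C : X →L[ℂ] X} {p M : ℝ} (hp : 0 < p) (hcomm : ∀ t : ℝ, 0 ≤ t → Commute (T t) C) {x : X}
    (hM : 0 ≤ M) (h : ∫⁻ t in Ioi (0 : ℝ), ENNReal.ofReal (‖C (T t x)‖ ^ p) ≤
      ENNReal.ofReal (M * ‖x‖ ^ p)) {t : ℝ} (ht : 0 < t) :
    t * ‖C (T t x)‖ ^ p ≤ hT.bound ^ p * (M * ‖x‖ ^ p) := by
  have hK := hT.bound_nonneg
  have h1 : ∀ s ∈ Ioc 0 t, ENNReal.ofReal (‖C (T t x)‖ ^ p) ≤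
      ENNReal.ofReal (hT.bound ^ p) * ENNReal.ofReal (‖C (T s x)‖ ^ p) := by
    intro s hs
    rw [← ENNReal.ofReal_mul (by positivity), ← Real.mul_rpow hK (norm_nonneg _)]
    refine ENNReal.ofReal_le_ofReal (Real.rpow_le_rpow (norm_nonneg _) ?_ hp.le)
    have hts : 0 ≤ t - s := sub_nonneg.mpr hs.2
    have e := hT.map_add_apply hts hs.1.le x
    rw [sub_add_cancel] at e
    rw [e, ← mul_apply_eq_comp, ← (hcomm _ hts).eq]
    exact hT.norm_apply_le hts _
  have h2 : ENNReal.ofReal (t * ‖C (T t x)‖ ^ p) ≤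
      ENNReal.ofReal (hT.bound ^ p * (M * ‖x‖ ^ p)) := by
    calc ENNReal.ofReal (t * ‖C (T t x)‖ ^ p)
        = ∫⁻ _ in Ioc 0 t, ENNReal.ofReal (‖C (T t x)‖ ^ p) := by
          rw [setLIntegral_const, Real.volume_Ioc, sub_zero, mul_comm,
            ENNReal.ofReal_mul (by positivity)]
      _ ≤ ∫⁻ s in Ioc 0 t,
          ENNReal.ofReal (hT.bound ^ p) * ENNReal.ofReal (‖C (T s x)‖ ^ p) :=
          setLIntegral_mono' measurableSet_Ioc h1
      _ ≤ ∫⁻ s in Ioi 0,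
          ENNReal.ofReal (hT.bound ^ p) * ENNReal.ofReal (‖C (T s x)‖ ^ p) :=
          lintegral_mono_set Ioc_subset_Ioi_self
      _ = ENNReal.ofReal (hT.bound ^ p) *
          ∫⁻ s in Ioi 0, ENNReal.ofReal (‖C (T s x)‖ ^ p) :=
          lintegral_const_mul' _ _ ENNReal.ofReal_ne_top
      _ ≤ ENNReal.ofReal (hT.bound ^ p) * ENNReal.ofReal (M * ‖x‖ ^ p) := by gcongr
      _ = _ := (ENNReal.ofReal_mul (by positivity)).symm
  exact (ENNReal.ofReal_le_ofReal_iff (by positivity)).mp h2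

theorem LpInfiniteTimeAdmissible.polyDecay [CompleteSpace X] (hT : IsBoundedC0Semigroup T)
    {C : X →L[ℂ] X} {p : ℝ} (hp : 0 < p) (hcomm : ∀ t : ℝ, 0 ≤ t → Commute (T t) C)
    (h : LpInfiniteTimeAdmissible p T C) : PolyDecay T C (1 / p) := by
  obtain ⟨M, hM, H⟩ := h
  have hK := hT.bound_nonneg
  refine ⟨hT.bound * M ^ (1 / p), by positivity, fun t ht => ?_⟩
  refine ContinuousLinearMap.opNorm_le_bound _ (by positivity) fun x => ?_
  have hcl : IsClosed {x : X | ‖(T t * C) x‖ ≤ hT.bound * M ^ (1 / p) * t ^ (-(1 / p)) * ‖x‖} :=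
    isClosed_le (by fun_prop) (by fun_prop)
  -- Admissibility speaks only of the domain of the generator; its density and closedness of the
  -- estimate give all of `X`.
  refine hcl.closure_subset_iff.mpr (fun y hy => ?_) (hT.dense_domain x)
  have h1 := hT.norm_rpow_le_of_admissible hp hcomm hM.le (H y hy) ht
  rw [← le_div_iff₀' ht] at h1
  have h2 := Real.rpow_le_rpow (by positivity) h1 (one_div_nonneg.mpr hp.le)
  rw [← Real.rpow_mul (norm_nonneg _), mul_one_div_cancel hp.ne', Real.rpow_one,
    Real.div_rpow (by positivity) ht.le, Real.mul_rpow (by positivity) (by positivity),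
    Real.mul_rpow hM.le (by positivity), ← Real.rpow_mul hK, ← Real.rpow_mul (norm_nonneg _),
    mul_one_div_cancel hp.ne', Real.rpow_one, Real.rpow_one] at h2
  rw [Set.mem_ofPred_eq, (hcomm t ht.le).eq, mul_apply_eq_comp]
  refine h2.trans_eq ?_
  rw [Real.rpow_neg ht.le]
  ring

theorem PolyDecay.lpInfiniteTimeAdmissible (hT : IsBoundedC0Semigroup T)
    {C : X →L[ℂ] X} {p b : ℝ} (hp : 0 < p) (hcomm : ∀ t : ℝ, 0 ≤ t → Commute (T t) C)
    (h : PolyDecay T C b) (hb : 1 < b * p) : LpInfiniteTimeAdmissible p T C := by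
  obtain ⟨c, hc, H⟩ := h
  have hK := hT.bound_nonneg
  have hint : IntegrableOn (fun t : ℝ => t ^ (-(b * p))) (Ioi 1) :=
    integrableOn_Ioi_rpow_of_lt (by linarith) one_pos
  have hI : 0 ≤ ∫ t in Ioi (1 : ℝ), t ^ (-(b * p)) :=
    setIntegral_nonneg measurableSet_Ioi fun t ht =>
      Real.rpow_nonneg (zero_le_one.trans (le_of_lt ht)) _
  -- The summands bound the integrals over `(0, 1]` and `(1, ∞)`; the final `1` only keeps the
  -- constant positive.
  refine ⟨(‖C‖ * hT.bound) ^ p + (∫ t in Ioi (1 : ℝ), t ^ (-(b * p))) * c ^ p + 1,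
    by positivity, fun x _ => ?_⟩
  have h1 : ∫⁻ t in Ioc (0 : ℝ) 1, ENNReal.ofReal (‖C (T t x)‖ ^ p) ≤
      ENNReal.ofReal ((‖C‖ * hT.bound) ^ p * ‖x‖ ^ p) := by
    calc _ ≤ ∫⁻ t in Ioc (0 : ℝ) 1, ENNReal.ofReal ((‖C‖ * hT.bound) ^ p * ‖x‖ ^ p) := by
          refine setLIntegral_mono' measurableSet_Ioc fun t ht => ENNReal.ofReal_le_ofReal ?_
          rw [← Real.mul_rpow (by positivity) (by positivity), mul_assoc]
          exact Real.rpow_le_rpow (norm_nonneg _)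
            (C.le_opNorm_of_le (hT.norm_apply_le ht.1.le x)) hp.le
      _ = _ := by simp
  have h2 : ∫⁻ t in Ioi (1 : ℝ), ENNReal.ofReal (‖C (T t x)‖ ^ p) ≤
      ENNReal.ofReal ((∫ t in Ioi (1 : ℝ), t ^ (-(b * p))) * c ^ p * ‖x‖ ^ p) := by
    rw [mul_assoc, ← integral_mul_const, ofReal_integral_eq_lintegral_ofReal (hint.mul_const _)]
    · refine setLIntegral_mono' measurableSet_Ioi fun t ht => ENNReal.ofReal_le_ofReal ?_
      have ht : 0 < t := one_pos.trans ht
      have h3 : ‖C (T t x)‖ ≤ c * t ^ (-b) * ‖x‖ := by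
        rw [← mul_apply_eq_comp, ← (hcomm t ht.le).eq]
        exact (T t * C).le_of_opNorm_le (H t ht) x
      refine (Real.rpow_le_rpow (norm_nonneg _) h3 hp.le).trans_eq ?_
      rw [Real.mul_rpow (by positivity) (by positivity), Real.mul_rpow hc (by positivity),
        ← Real.rpow_mul ht.le, neg_mul]
      ring
    · filter_upwards [ae_restrict_mem measurableSet_Ioi] with t ht
      have : (0 : ℝ) < t := one_pos.trans ht
      positivity
  rw [← Ioc_union_Ioi_eq_Ioi zero_le_one, lintegral_union measurableSet_Ioi
    (Ioc_disjoint_Ioi le_rfl)]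
  refine (add_le_add h1 h2).trans ?_
  rw [← ENNReal.ofReal_add (by positivity) (by positivity)]
  refine ENNReal.ofReal_le_ofReal ?_
  rw [← add_mul]
  exact mul_le_mul_of_nonneg_right (by linarith) (by positivity)

variable [CompleteSpace X]

/-- Decay of order `κ` along `(-A)^{-1}` gives decay of order `κ s` along `(-A)^{-s}`. -/
theorem IsBoundedC0Semigroup.polyDecay_negPowNeg (hT : IsBoundedC0Semigroup T)
    (h0 : (0 : ℂ) ∈ opResolventSet (generator T)) {κ : ℝ}
    (h : PolyDecay T (negPowNeg (generator T) 1) κ) {s : ℝ} (hs : 0 ≤ s) :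
    PolyDecay T (negPowNeg (generator T) s) (κ * s) := by
  have hc1 : ∀ t : ℝ, 0 ≤ t → Commute (T t) (negPowNeg (generator T) 1) :=
    fun t => hT.commute_negPowNeg h0 zero_le_one
  have hfl : (⌊s⌋₊ : ℝ) + Int.fract s = s := by
    rw [natCast_floor_eq_intCast_floor hs, Int.floor_add_fract]
  have hr0 := Int.fract_nonneg s
  have hr1 := Int.fract_lt_one s
  have hn := h.pow hT hc1 ⌊s⌋₊
  rw [hT.negPowNeg_pow h0 zero_le_one, mul_one] at hn
  have hr : PolyDecay T (negPowNeg (generator T) (Int.fract s)) (κ * Int.fract s) := by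
    rcases hr0.eq_or_lt with hr | hr
    · rw [← hr, mul_zero, negPowNeg_zero]
      exact hT.polyDecay_one
    · exact h.interpolate hT (hT.momentBound_one h0 hr hr1) hr0 hr1.le
        (fun t => hT.commute_negPowNeg h0 hr0) hc1
  have := hn.mul hT.toIsC0Semigroup hr fun t => hT.commute_negPowNeg h0 (Nat.cast_nonneg _)
  rwa [← hT.negPowNeg_add h0 (Nat.cast_nonneg _) hr0, hfl,
    show ⌊s⌋₊ * κ + κ * Int.fract s = κ * (⌊s⌋₊ + Int.fract s) by ring, hfl] at this

/-- Decay of order `κ γ` along `(-A)^{-γ}` gives decay of order `κ` along `(-A)^{-1}`. -/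
theorem IsBoundedC0Semigroup.polyDecay_negPowNeg_one (hT : IsBoundedC0Semigroup T)
    (h0 : (0 : ℂ) ∈ opResolventSet (generator T)) {κ γ : ℝ} (hγ : 0 < γ)
    (h : PolyDecay T (negPowNeg (generator T) γ) (κ * γ)) :
    PolyDecay T (negPowNeg (generator T) 1) κ := by
  have hcomm : ∀ {s : ℝ}, 0 ≤ s → ∀ t : ℝ, 0 ≤ t → Commute (T t) (negPowNeg (generator T) s) :=
    fun hs t => hT.commute_negPowNeg h0 hs
  -- The moment inequality below `(-A)^{-β}` is available only for `1 ≤ β < 2`, so the decay is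
  -- first moved from `γ` into this window.
  obtain ⟨β, hβ1, hβ2, hβ⟩ : ∃ β : ℝ, 1 ≤ β ∧ β < 2 ∧
      PolyDecay T (negPowNeg (generator T) β) (κ * β) := by
    rcases lt_or_ge γ 1 with hγ1 | hγ1
    -- For `γ < 1`, the first multiple of `γ` reaching `1` is below `1 + γ < 2`, and powers multiply
    -- the decay order.
    · refine ⟨⌈1 / γ⌉₊ * γ, ?_, ?_, ?_⟩
      · have := Nat.le_ceil (1 / γ)
        rwa [div_le_iff₀ hγ] at this
      · have := Nat.ceil_lt_add_one (a := 1 / γ) (by positivity)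
        have := mul_lt_mul_of_pos_right this hγ
        rw [add_mul, one_div_mul_cancel hγ.ne'] at this
        linarith
      · have := h.pow hT (hcomm hγ.le) ⌈1 / γ⌉₊
        rw [hT.negPowNeg_pow h0 hγ.le] at this
        convert this using 1
        ring
    -- For `γ ≥ 1`, this `m` puts `δ = γ / m` in `[1/2, 1)`. Since `(-A)^{-γ}` is the `m`-th power
    -- of `(-A)^{-δ}`, interpolation gives decay at `δ`, and squaring gives it at `β = 2 δ`.
    · set m := ⌊γ⌋₊ + 1 with hm
      have hm0 : (0 : ℝ) < m := by positivity
      have hδ : 0 ≤ γ / m := by positivity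
      have hδ1 : 1 / 2 ≤ γ / m := by
        rw [div_le_div_iff₀ two_pos hm0, hm]
        push_cast
        have := Nat.floor_le hγ.le
        linarith
      have hδ2 : γ / m < 1 := by
        rw [div_lt_one hm0, hm]
        push_cast
        exact Nat.lt_floor_add_one γ
      have hmom := (hT.momentBound_half h0 hδ1 hδ2).pow (m := m) (by positivity)
      rw [hT.negPowNeg_pow h0 hδ, mul_div_cancel₀ _ hm0.ne'] at hmom
      have hm1 : 1 / (m : ℝ) ≤ 1 := by
        rw [div_le_one hm0, hm]
        push_cast
        linarith [Nat.cast_nonneg (α := ℝ) ⌊γ⌋₊]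
      have hd := h.interpolate hT hmom (by positivity) hm1 (hcomm hδ) (hcomm hγ.le)
      have hd2 := hd.mul hT.toIsC0Semigroup hd (hcomm hδ)
      rw [← hT.negPowNeg_add h0 hδ hδ] at hd2
      refine ⟨γ / m + γ / m, by linarith, by linarith, ?_⟩
      convert hd2 using 1
      ring
  have := hβ.interpolate hT (hT.momentBound_of_one_le h0 hβ1 hβ2) (by positivity)
    (by rw [div_le_one (by linarith)]; exact hβ1) (hcomm zero_le_one) (hcomm (by linarith))
  rwa [mul_one_div, mul_div_cancel_right₀ _ (by linarith : β ≠ 0)] at this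

end Admissibility

theorem mainTheorem8 {X : Type*} [NormedAddCommGroup X] [NormedSpace ℂ X] [CompleteSpace X]
    (T : ℝ → X →L[ℂ] X) (hT : IsBoundedC0Semigroup T)
    (h0 : (0 : ℂ) ∈ opResolventSet (generator T))
    (α p : ℝ) (hα : 0 < α) (hp : 1 ≤ p) :
    (LpInfiniteTimeAdmissible p T (negPowNeg (generator T) (α / p)) →
      (fun t : ℝ => ‖(T t).comp (opInverse (generator T))‖)
        =O[atTop] (fun t : ℝ => t ^ (-(1 / α)))) ∧
    ((fun t : ℝ => ‖(T t).comp (opInverse (generator T))‖)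
        =O[atTop] (fun t : ℝ => t ^ (-(1 / α))) →
      ∀ ε : ℝ, 0 < ε →
        LpInfiniteTimeAdmissible p T (negPowNeg (generator T) (α / p + ε))) := by
  have hp0 : 0 < p := by linarith
  constructor
  · intro h
    refine (hT.polyDecay_negPowNeg_one h0 (γ := α / p) (by positivity) ?_).isBigO
    have := h.polyDecay hT hp0 fun t => hT.commute_negPowNeg h0 (by positivity)
    rwa [show 1 / α * (α / p) = 1 / p by field_simp]
  · intro h ε hε
    have hd := hT.polyDecay_of_isBigO (one_div_nonneg.mpr hα.le) h
    refine (hT.polyDecay_negPowNeg h0 hd (s := α / p + ε) (by positivity)).lpInfiniteTimeAdmissible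
      hT hp0 (fun t => hT.commute_negPowNeg h0 (by positivity)) ?_
    -- The decay order times `p` exceeds the critical value `1` by exactly the contribution of `ε`.
    have : 1 / α * (α / p + ε) * p = 1 + ε * p / α := by field_simp
    rw [this]
    linarith [show 0 < ε * p / α by positivity]
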